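/- For a sign $\epsilon\in\{+,-\}$ and $n\ge 0$, a signed $n$-partition (resp. signed $n$-half-partition) is a vector $\lambda_\epsilon=(\lambda_1,\dots,\lambda_{n-1},\epsilon\lambda_n)$ with $\lambda_1\ge\dots\ge\lambda_n\ge 0$ all in $\mathbb Z$ (resp. all in $\frac12+\mathbb Z$); it is unsigned if $\epsilon=+$. An orthogonal pattern of height $N$ is an array $z=(z_{i,j})_{1\le i\le N,\ 1\le j\le\lceil i/2\rceil}$ with entries all in $\mathbb Z$ or all in $\frac12+\mathbb Z$, such that all entries other than the $z_{2i-1,i}$ are non-negative and $|z_{i+1,j+1}|\le|z_{i,j}|\le|z_{i+1,j}|$ whenever these entries exist. Its shape is its bottom row, and its type is given by $\mathrm{type}(z)_i=\sum_{j\le\lceil i/2\rceil}|z_{i,j}|-\sum_{j\le\lceil (i-1)/2\rceil}|z_{i-1,j}|$. With $\mathrm{sign}(a)=+1$ for $a\ge 0$ and $\mathrm{sign}(a)=-1$ for $a<0$, put $$w_z(x)=x_1^{z_{1,1}}\prod_{i=2}^n x_i^{\mathrm{sign}(z_{2i-3,i-1})\,\mathrm{sign}(z_{2i-1,i})\,[\mathrm{type}(z)_{2i-1}-\mathrm{type}(z)_{2i-2}]},\qquad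 x=(x_1,\dots,x_n).$$ The even orthogonal character $\mathrm{so}^{(2n)}_{\lambda_\epsilon}(x)$, for a signed $n$-partition or signed $n$-half-partition $\lambda_\epsilon$, is $\sum_z w_z(x)$ over all orthogonal patterns $z$ of height $2n-1$ and shape $\lambda_\epsilon$. The odd orthogonal character $\mathrm{so}^{(2n+1)}_{\lambda}(x)$, for an $n$-partition or $n$-half-partition $\lambda$, is $\sum_z w_z(x)$ over all orthogonal patterns $z$ of height $2n$ and shape $\lambda$. Both are Laurent polynomials in $x_1^{1/2},\dots,x_n^{1/2}$, equal to $1$ for $n=0$. Write $u^{(k)}=(u,\dots,u)$ ($k$ entries) and $u^{(k)}_\epsilon=(u,\dots,u,\epsilon u)$. A sum over $\lambda_\delta\subseteq u^{(m)}$ runs over all signed $m$-partitions (if $u\in\mathbb Z$) or signed $m$-half-partitions (if $u\in\frac12+\mathbb Z$) $\lambda_\delta=(\lambda_1,\dots,\lambda_{m-1},\delta\lambda_m)$ with $\lambda_1\le u$, each vector being counted once (so $\lambda_+=\lambda_-$ gives a single term when $\lambda_m=0$). **Theorem.** Let $u\in\frac12\mathbb Z_{\ge 0}$, let $n,m\ge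 0$ be integers, and let $x=(x_1,\dots,x_n)$, $y=(y_1,\dots,y_m)$ be variables. If $n\ge m$ and $\epsilon$ is a sign (with $\epsilon=+$ if $m=0$), then $$\mathrm{so}^{(2n+2m)}_{u^{(n+m)}_{\epsilon}}(x,y)=\sum_{\lambda_\delta\subseteq u^{(m)}}\mathrm{so}^{(2n)}_{(u^{(n-m)},\lambda_\delta)}(x)\cdot\mathrm{so}^{(2m)}_{\lambda_{\delta\epsilon}}(y).$$ If $n+1\ge m$, then $$\mathrm{so}^{(2n+2m+1)}_{u^{(n+m)}}(x,y)=\sum_{\lambda_\delta\subseteq u^{(m)}}\mathrm{so}^{(2n+2)}_{(u^{(n+1-m)},\lambda_\delta)}(x,1)\cdot\mathrm{so}^{(2m)}_{\lambda_\delta}(y),$$ where $1^{1/2}=1$. These are identities of Laurent polynomials in the $x_i^{1/2}$ and $y_j^{1/2}$; equivalently, they hold in every commutative ring for all $x_i,y_j$ with chosen invertible square roots $x_i^{1/2},y_j^{1/2}$. -/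

import Mathlib

/-!
Conventions. All numbers in `½ℤ` (entries of patterns, parts of (half-)partitions, exponents) are
stored doubled: the integer `a` stands for `a / 2`. So even integers stand for integers and odd
integers for half-integers. Accordingly the variables `x i` are given through square roots `r i`,
units of a commutative ring with `x i = (r i) ^ 2`, and the monomial `x i ^ (a / 2)` is `r i ^ a`.
A Laurent polynomial identity in the `x i ^ (1 / 2)` is the same as the identity for all such `r`.
-/

namespace OrthogonalCharacters

/-- The sign of an integer, with the convention that the sign of `0` is `+1`. -/
def sgn (a : ℤ) : ℤ := if 0 ≤ a then 1 else -1

/-- `(i, j)` is a position of the half-triangular array of height `N`: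
`1 ≤ i ≤ N` and `1 ≤ j ≤ ⌈i / 2⌉`. -/
def IsPosition (N i j : ℕ) : Prop := 1 ≤ i ∧ i ≤ N ∧ 1 ≤ j ∧ j ≤ (i + 1) / 2

/-- Orthogonal patterns of height `N`: half-triangular arrays `z i j` (indexed from `1`, extended by
zero outside the array) of integers or of half-integers, in which only the odd ends
`z (2 * p - 1) p` may be negative, and which interlace in absolute value. -/
structure IsOrthogonalPattern (N : ℕ) (z : ℕ → ℕ → ℤ) : Prop where
  zero_outside : ∀ i j, ¬ IsPosition N i j → z i j = 0
  integral : (∀ i j, IsPosition N i j → Even (z i j)) ∨ (∀ i j, IsPosition N i j → Odd (z i j))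
  nonneg : ∀ i j, IsPosition N i j → i ≠ 2 * j - 1 → 0 ≤ z i j
  le_below : ∀ i j, IsPosition N i j → IsPosition N (i + 1) j → |z i j| ≤ |z (i + 1) j|
  below_le : ∀ i j, IsPosition N i j → IsPosition N (i + 1) (j + 1) →
    |z (i + 1) (j + 1)| ≤ |z i j|

/-- The orthogonal patterns of height `N` whose bottom row is `lam`
(used with `lam` of length `n = ⌈N / 2⌉`). -/
def orthogonalPatterns (N : ℕ) {n : ℕ} (lam : Fin n → ℤ) : Set (ℕ → ℕ → ℤ) :=
  {z | IsOrthogonalPattern N z ∧ ∀ j : Fin n, z N (j + 1) = lam j}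

theorem orthogonalPatterns_finite (N : ℕ) {n : ℕ} (hN : (N + 1) / 2 ≤ n) (lam : Fin n → ℤ) :
    (orthogonalPatterns N lam).Finite := by
  have key : ∀ z ∈ orthogonalPatterns N lam, ∀ d i j, i + d = N → IsPosition N i j →
      |z i j| ≤ ∑ l, |lam l| := by
    rintro z ⟨hz, hs⟩ d
    induction d with
    | zero =>
      intro i j hi hp
      have hp' := hp
      obtain ⟨h1, h2, h3, h4⟩ := hp'
      have hiN : i = N := by omega
      subst hiN
      have hj : j - 1 < n := by omega
      have h := hs ⟨j - 1, hj⟩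
      have hj' : j - 1 + 1 = j := by omega
      simp only [hj'] at h
      rw [h]
      exact Finset.single_le_sum (f := fun l => |lam l|) (fun l _ => abs_nonneg _)
        (Finset.mem_univ (⟨j - 1, hj⟩ : Fin n))
    | succ d ih =>
      intro i j hi hp
      have hp' : IsPosition N (i + 1) j := by
        obtain ⟨h1, h2, h3, h4⟩ := hp
        exact ⟨by omega, by omega, h3, by omega⟩
      exact (hz.le_below i j hp hp').trans (ih (i + 1) j (by omega) hp')
  let B : ℤ := ∑ l, |lam l|
  let ι := Fin (N + 1) × Fin (N + 1)
  have hfin : (Set.pi Set.univ (fun _ : ι => Set.Icc (-B) B)).Finite :=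
    Set.Finite.pi' (fun _ => Set.finite_Icc _ _) |>.subset (fun f hf i => hf i (Set.mem_univ i))
  refine Set.Finite.of_finite_image (f := fun z (p : ι) => z p.1 p.2) (hfin.subset ?_) ?_
  · rintro _ ⟨z, hz, rfl⟩ p -
    by_cases hp : IsPosition N p.1 p.2
    · exact abs_le.mp (key z hz (N - p.1) p.1 p.2 (by have := hp.2.1; omega) hp)
    · have hB : 0 ≤ B := Finset.sum_nonneg (fun _ _ => abs_nonneg _)
      simp only [hz.1.zero_outside _ _ hp, Set.mem_Icc]
      constructor <;> omega
  · intro z hz w hw h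
    funext i j
    by_cases hp : IsPosition N i j
    · obtain ⟨h1, h2, h3, h4⟩ := hp
      exact congrFun h (⟨i, by omega⟩, ⟨j, by omega⟩)
    · rw [hz.1.zero_outside _ _ hp, hw.1.zero_outside _ _ hp]

/-- The `i`-th component of the type of a pattern:
`∑_{j ≤ ⌈i / 2⌉} |z i j| - ∑_{j ≤ ⌈(i - 1) / 2⌉} |z (i - 1) j|`. -/
noncomputable def patternType (z : ℕ → ℕ → ℤ) (i : ℕ) : ℤ :=
  ∑ j ∈ Finset.Icc 1 ((i + 1) / 2), |z i j| - ∑ j ∈ Finset.Icc 1 (i / 2), |z (i - 1) j|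

/-- The exponent of the `i`-th variable (`i ≥ 1`) in the weight monomial of a pattern. -/
noncomputable def weightExponent (z : ℕ → ℕ → ℤ) (i : ℕ) : ℤ :=
  if i = 1 then z 1 1
  else sgn (z (2 * i - 3) (i - 1)) * sgn (z (2 * i - 1) i) *
    (patternType z (2 * i - 1) - patternType z (2 * i - 2))

variable {R : Type*} [CommRing R]

/-- The weight monomial `∏ i, x i ^ (weightExponent z i)`, in terms of square roots `r` of the
variables; the variable `x_{i + 1}` of the usual numbering has index `i : Fin n`. -/
noncomputable def patternWeight {n : ℕ} (r : Fin n → Rˣ) (z : ℕ → ℕ → ℤ) : R :=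
  ((∏ i : Fin n, r i ^ weightExponent z (i + 1) : Rˣ) : R)

/-- The `(2n)`-orthogonal Schur polynomial (the character of `SO_{2n}`) indexed by a signed
`n`-(half-)partition, as generating function of orthogonal patterns of height `2n - 1`. -/
noncomputable def soEven {n : ℕ} (lam : Fin n → ℤ) (r : Fin n → Rˣ) : R :=
  ∑ z ∈ (orthogonalPatterns_finite (2 * n - 1) (by omega) lam).toFinset, patternWeight r z

/-- The `(2n + 1)`-orthogonal Schur polynomial (the character of `SO_{2n + 1}`) indexed by an
`n`-(half-)partition, as generating function of orthogonal patterns of height `2n`. -/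
noncomputable def soOdd {n : ℕ} (lam : Fin n → ℤ) (r : Fin n → Rˣ) : R :=
  ∑ z ∈ (orthogonalPatterns_finite (2 * n) (by omega) lam).toFinset, patternWeight r z

/-- The finite set of the signed `m`-(half-)partitions `lam_δ ⊆ u^(m)`, where `u = k / 2`: vectors
`(lam_1, …, lam_{m-1}, δ lam_m)` with `u ≥ lam_1 ≥ ⋯ ≥ lam_m ≥ 0`, whose entries are all integers or
all half-integers according to which of the two `u` is. The vector is counted once if
`lam_m = 0`. -/
noncomputable def signedPartitionsIn (m k : ℕ) : Finset (Fin m → ℤ) :=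
  (Fintype.piFinset fun _ : Fin m => Finset.Icc (-(k : ℤ)) k).filter fun lam =>
    (∀ i, Even (lam i - k)) ∧ ∀ i j, i < j → |lam j| ≤ lam i

/-- The rectangular (half-)partition `u^(n) = (u, …, u)`, where `u = k / 2`. -/
def rect (k n : ℕ) : Fin n → ℤ := fun _ => k

/-- The vector `lam` with its last entry multiplied by the sign `ε`. -/
def withSign {n : ℕ} (ε : ℤˣ) (lam : Fin n → ℤ) : Fin n → ℤ :=
  fun i => if (i : ℕ) + 1 = n then ε * lam i else lam i

/-- The vector `(u^(n - m), lam)` of length `n`, where `u = k / 2` and `lam` has length `m ≤ n`. -/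
def rectAppend (k n : ℕ) {m : ℕ} (lam : Fin m → ℤ) : Fin n → ℤ :=
  fun i => if h : n - m ≤ (i : ℕ) then lam ⟨i - (n - m), by omega⟩ else k

end OrthogonalCharacters

/-! The heart of the proof is a duality of one-variable branching coefficients. Cutting the last two
rows off a pattern gives so_lam(x, q) = ∑_nu b(lam, nu; q) so_nu(x) (`soEven_succ`), where b sums
powers of q over the even rows mu between nu and lam. If lam = (u, u, al) and nu = be, then mu
starts with u, and what remains of the inequalities and of the exponent is symmetric in al and be.
Hence b((u, u, al), be) = b(be, al) (`branch_cons_cons_eq`); any further leading u is forced in both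
rows. So in ∑_al so_(u, …, u, al)(x) so_al(w) the last variable of x can be handed over to w
(`sum_soEven_rectAppend_succ`). With al empty the sum is the rectangular character in (x, y), and
handing over all of y gives the even identity.

The variables y arrive in reverse order, so symmetry of the characters is needed. It follows from
the Weyl character formula 2 V so_lam = A_+ + A_-, where A_± = det(x_i^(l_j) ± x_i^(-l_j)) with l_j
= lam_j + n - j, and V is the Vandermonde product in the x_i + 1/x_i. The formula holds because each
alternant obeys the branching rule of the characters, up to the factors of V
(`sum_branch_mul_alternant`): the sums over nu and then over mu are taken column by column in a
determinant, and every one telescopes. Cancelling V is legitimate for Laurent polynomials over ℤ,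
and the result is specialised to every commutative ring.

Changing the sign of the last part inverts the last variable (`soEven_withSign_neg`), which gives ε
= -. For a rectangular shape the odd character is the even one with an additional variable 1
(`soOdd_rect`), and symmetry moves that 1 next to x. -/

namespace OrthogonalCharacters

variable {R : Type*} [CommRing R]

/-! ### Intervals of fixed parity and telescoping -/

/-- The integers in `[a, b]` of the same parity as `k`. -/
noncomputable def parityIcc (k a b : ℤ) : Finset ℤ := (Finset.Icc a b).filter fun t => Even (t - k)

theorem mem_parityIcc {k a b t : ℤ} : t ∈ parityIcc k a b ↔ (a ≤ t ∧ t ≤ b) ∧ Even (t - k) := by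
  simp [parityIcc]

theorem sum_parityIcc_telescope {M : Type*} [AddCommGroup M] (G : ℤ → M) {k a b : ℤ}
    (ha : Even (a - k)) (hb : Even (b - k)) (hab : a ≤ b + 2) :
    ∑ t ∈ parityIcc k a b, (G (t + 2) - G t) = G (b + 2) - G a := by
  -- Here d is the number of terms; d = 0 is the empty interval with b = a - 2.
  obtain ⟨d, hd⟩ : ∃ d : ℕ, b = a + 2 * d - 2 := by
    obtain ⟨x, hx⟩ := ha
    obtain ⟨y, hy⟩ := hb
    exact ⟨(y - x + 1).toNat, by omega⟩
  subst hd
  clear hab hb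
  induction d with
  | zero =>
    rw [show parityIcc k a (a + 2 * ((0 : ℕ) : ℤ) - 2) = ∅ from ?_]
    · simp
    · ext t
      simp only [mem_parityIcc, Finset.notMem_empty, iff_false]
      rintro ⟨⟨h1, h2⟩, -⟩
      push_cast at h2
      omega
  | succ d ih =>
    rw [show parityIcc k a (a + 2 * ((d + 1 : ℕ) : ℤ) - 2) =
      insert (a + 2 * (d : ℤ)) (parityIcc k a (a + 2 * (d : ℤ) - 2)) from ?_, Finset.sum_insert, ih]
    · push_cast
      rw [show a + 2 * (d : ℤ) - 2 + 2 = a + 2 * d by ring,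
        show a + 2 * ((d : ℤ) + 1) - 2 + 2 = a + 2 * d + 2 by ring]
      abel
    · simp only [mem_parityIcc]
      omega
    · ext t
      simp only [mem_parityIcc, Finset.mem_insert]
      obtain ⟨x, hx⟩ := ha
      constructor
      · rintro ⟨⟨h1, h2⟩, ⟨y, hy⟩⟩
        by_cases h : t = a + 2 * (d : ℤ)
        · exact Or.inl h
        · push_cast at h2
          exact Or.inr ⟨⟨h1, by omega⟩, ⟨y, hy⟩⟩
      · rintro (rfl | ⟨⟨h1, h2⟩, h3⟩)
        · push_cast
          exact ⟨⟨by omega, by omega⟩, ⟨x + d, by omega⟩⟩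
        · push_cast
          exact ⟨⟨by omega, by omega⟩, h3⟩

theorem mem_signedPartitionsIn {m k : ℕ} {lam : Fin m → ℤ} :
    lam ∈ signedPartitionsIn m k ↔
      (∀ i, |lam i| ≤ k) ∧ (∀ i, Even (lam i - k)) ∧ ∀ i j, i < j → |lam j| ≤ lam i := by
  simp [signedPartitionsIn, abs_le]

theorem abs_of_mem_signedPartitionsIn {n k : ℕ} {lam : Fin (n + 1) → ℤ}
    (h : lam ∈ signedPartitionsIn (n + 1) k) (j : Fin n) : |lam j.castSucc| = lam j.castSucc :=
  abs_of_nonneg <| (abs_nonneg _).trans <|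
    (mem_signedPartitionsIn.1 h).2.2 j.castSucc j.succ (Fin.castSucc_lt_succ)

theorem even_abs_sub {a k : ℤ} (h : Even (a - k)) : Even (|a| - k) := by
  rcases abs_choice a with h' | h' <;> rw [h']
  · exact h
  · obtain ⟨x, hx⟩ := h
    exact ⟨-x - k, by omega⟩

/-! ### One-variable branching coefficients -/

/-- The sign of the last entry (`1` for the empty vector). -/
def lastSgn : {n : ℕ} → (Fin n → ℤ) → ℤ
  | 0, _ => 1
  | n + 1, nu => sgn (nu (Fin.last n))

/-- The absolute values of `nu`, preceded by that of the first entry of `lam`. -/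
def extendAbs {n : ℕ} (lam : Fin (n + 1) → ℤ) (nu : Fin n → ℤ) : Fin (n + 1) → ℤ :=
  Fin.cons |lam 0| fun j => |nu j|

/-- The lower bounds for a row between `nu` and `lam`. -/
def lower {n : ℕ} (lam : Fin (n + 1) → ℤ) (nu : Fin n → ℤ) (j : Fin n) : ℤ :=
  max |lam j.succ| |nu j|

/-- The upper bounds for a row between `nu` and `lam`. -/
def upper {n : ℕ} (lam : Fin (n + 1) → ℤ) (nu : Fin n → ℤ) (j : Fin n) : ℤ :=
  min |lam j.castSucc| (extendAbs lam nu j.castSucc)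

/-- The possible (even) rows between the odd rows `nu` and `lam` of a pattern. -/
noncomputable def between (k : ℤ) {n : ℕ} (lam : Fin (n + 1) → ℤ) (nu : Fin n → ℤ) :
    Finset (Fin n → ℤ) :=
  Fintype.piFinset fun j => parityIcc k (lower lam nu j) (upper lam nu j)

/-- The one-variable branching coefficient from `SO(2n + 2)` to `SO(2n)`. -/
noncomputable def branch (k : ℤ) {n : ℕ} (lam : Fin (n + 1) → ℤ) (nu : Fin n → ℤ) (q : Rˣ) : R :=
  ∑ mu ∈ between k lam nu,
    ((q ^ (lastSgn lam * lastSgn nu * (∑ i, |lam i| + ∑ j, |nu j| - 2 * ∑ j, mu j)) : Rˣ) : R)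

/-- Compare lam with `extendAbs lam nu` entry by entry: the lower bounds are the maxima from index 1
on, the upper bounds the minima up to the last but one. Since max + min is the sum, only the maximum
|lam 0| at index 0 and the last minimum have to be corrected for. -/
theorem sum_lower_add_upper {n : ℕ} (lam : Fin (n + 1) → ℤ) (nu : Fin n → ℤ) :
    ∑ j, (lower lam nu j + upper lam nu j) =
      ∑ i, |lam i| + ∑ j, |nu j| - min |lam (Fin.last n)| (extendAbs lam nu (Fin.last n)) := by
  have h1 := Fin.sum_univ_succ fun i => max |lam i| (extendAbs lam nu i)
  have h2 := Fin.sum_univ_castSucc fun i => min |lam i| (extendAbs lam nu i)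
  have h3 : ∑ i, max |lam i| (extendAbs lam nu i) + ∑ i, min |lam i| (extendAbs lam nu i) =
      ∑ i, |lam i| + ∑ i, extendAbs lam nu i := by
    rw [← Finset.sum_add_distrib, ← Finset.sum_add_distrib]
    exact Finset.sum_congr rfl fun i _ => max_add_min _ _
  have h4 := Fin.sum_univ_succ (extendAbs lam nu)
  simp only [extendAbs, Fin.cons_zero, Fin.cons_succ, max_self] at h1 h4
  rw [Finset.sum_add_distrib]
  simp only [lower, upper]
  simp only [extendAbs] at h2 h3 h4 ⊢
  linarith

theorem even_lower_sub {k : ℤ} {n : ℕ} {lam : Fin (n + 1) → ℤ} {nu : Fin n → ℤ}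
    (hl : ∀ i, Even (lam i - k)) (hn : ∀ i, Even (nu i - k)) (j : Fin n) :
    Even (lower lam nu j - k) := by
  rcases max_choice |lam j.succ| |nu j| with h | h <;> rw [lower, h]
  · exact even_abs_sub (hl _)
  · exact even_abs_sub (hn _)

theorem even_upper_sub {k : ℤ} {n : ℕ} {lam : Fin (n + 1) → ℤ} {nu : Fin n → ℤ}
    (hl : ∀ i, Even (lam i - k)) (hn : ∀ i, Even (nu i - k)) (j : Fin n) :
    Even (upper lam nu j - k) := by
  rcases min_choice |lam j.castSucc| (extendAbs lam nu j.castSucc) with h | h <;> rw [upper, h]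
  · exact even_abs_sub (hl _)
  · have : ∀ i, Even (extendAbs lam nu i - k) := by
      intro i
      refine Fin.cases ?_ (fun i => ?_) i
      · simpa [extendAbs] using even_abs_sub (hl 0)
      · simpa [extendAbs] using even_abs_sub (hn i)
    exact this _

/-- The rows between nu and lam form a box, which is stable under the reflection of every coordinate
in the midpoint of its interval. -/
theorem sum_between_reflect {k : ℤ} {n : ℕ} {lam : Fin (n + 1) → ℤ} {nu : Fin n → ℤ}
    (hl : ∀ i, Even (lam i - k)) (hn : ∀ i, Even (nu i - k)) (f : ℤ → R) :
    ∑ mu ∈ between k lam nu, f (∑ j, mu j) =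
      ∑ mu ∈ between k lam nu, f (∑ i, |lam i| + ∑ j, |nu j|
        - min |lam (Fin.last n)| (extendAbs lam nu (Fin.last n)) - ∑ j, mu j) := by
  have key : ∀ mu ∈ between k lam nu,
      (fun j => lower lam nu j + upper lam nu j - mu j) ∈ between k lam nu := by
    intro mu hmu
    simp only [between, Fintype.mem_piFinset, mem_parityIcc] at hmu ⊢
    intro j
    obtain ⟨⟨h1, h2⟩, ⟨x, hx⟩⟩ := hmu j
    obtain ⟨y, hy⟩ := even_lower_sub hl hn j
    obtain ⟨w, hw⟩ := even_upper_sub hl hn j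
    exact ⟨⟨by omega, by omega⟩, ⟨y + w - x, by omega⟩⟩
  refine Finset.sum_bij' (fun mu _ => fun j => lower lam nu j + upper lam nu j - mu j)
    (fun mu _ => fun j => lower lam nu j + upper lam nu j - mu j) key key ?_ ?_ ?_
  · intro mu _
    funext j
    ring
  · intro mu _
    funext j
    ring
  · intro mu _
    rw [Finset.sum_sub_distrib, sum_lower_add_upper]
    congr 1
    ring

theorem sgn_mul_abs (a : ℤ) : sgn a * |a| = a := by
  unfold sgn
  split_ifs with h
  · rw [abs_of_nonneg h, one_mul]
  · rw [abs_of_neg (by omega)]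
    ring

theorem sgn_neg {a : ℤ} (h : a ≠ 0) : sgn (-a) = -sgn a := by
  unfold sgn
  split_ifs <;> omega

theorem withSign_one {n : ℕ} (lam : Fin n → ℤ) : withSign 1 lam = lam := by
  funext i
  simp [withSign]

theorem withSign_castSucc {n : ℕ} (ε : ℤˣ) (lam : Fin (n + 1) → ℤ) (i : Fin n) :
    withSign ε lam i.castSucc = lam i.castSucc := by
  have := i.isLt
  simp only [withSign, Fin.val_castSucc]
  rw [if_neg (by omega)]

theorem withSign_last {n : ℕ} (ε : ℤˣ) (lam : Fin (n + 1) → ℤ) :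
    withSign ε lam (Fin.last n) = ε * lam (Fin.last n) := by
  simp [withSign]

theorem abs_withSign {n : ℕ} (ε : ℤˣ) (lam : Fin n → ℤ) (i : Fin n) :
    |withSign ε lam i| = |lam i| := by
  unfold withSign
  split_ifs
  · rcases Int.units_eq_one_or ε with rfl | rfl <;> simp
  · rfl

theorem withSign_mem {n k : ℕ} (ε : ℤˣ) {lam : Fin n → ℤ} (h : lam ∈ signedPartitionsIn n k) :
    withSign ε lam ∈ signedPartitionsIn n k := by
  rw [mem_signedPartitionsIn] at h ⊢
  obtain ⟨h1, h2, h3⟩ := h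
  refine ⟨fun i => by rw [abs_withSign]; exact h1 i, fun i => ?_, fun i j hij => ?_⟩
  · unfold withSign
    split_ifs
    · rcases Int.units_eq_one_or ε with rfl | rfl
      · simpa using h2 i
      · obtain ⟨x, hx⟩ := h2 i
        exact ⟨-x - k, by push_cast; omega⟩
    · exact h2 i
  · rw [abs_withSign]
    have : withSign ε lam i = lam i := by
      unfold withSign
      rw [if_neg]
      have := j.isLt
      have : (i : ℕ) < j := hij
      omega
    rw [this]
    exact h3 i j hij

/-- If the last entry is nonzero, its sign is a factor of the exponent. If it is zero, the vector
does not change; then the minimum in `sum_between_reflect` vanishes, and the reflection negates the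
exponent. -/
theorem branch_withSign_neg {k : ℤ} {n : ℕ} {lam : Fin (n + 1) → ℤ} {nu : Fin n → ℤ}
    (hl : ∀ i, Even (lam i - k)) (hn : ∀ i, Even (nu i - k)) (q : Rˣ) :
    branch k (withSign (-1) lam) nu q = branch k lam nu q⁻¹ := by
  by_cases h0 : lam (Fin.last n) = 0
  · have : withSign (-1) lam = lam := by
      funext i
      refine Fin.lastCases ?_ (fun i => ?_) i
      · rw [withSign_last, h0, mul_zero]
      · exact withSign_castSucc _ _ _
    rw [this, branch, branch,
      sum_between_reflect hl hn fun t => ((q ^ (lastSgn lam * lastSgn nu *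
        (∑ i, |lam i| + ∑ j, |nu j| - 2 * t)) : Rˣ) : R)]
    refine Finset.sum_congr rfl fun mu _ => ?_
    rw [inv_zpow', h0, abs_zero, min_eq_left]
    · congr 2
      ring
    · refine Fin.cases ?_ (fun i => ?_) (Fin.last n) <;> simp [extendAbs]
  · have hb : between k (withSign (-1) lam) nu = between k lam nu := by
      have he : extendAbs (withSign (-1) lam) nu = extendAbs lam nu := by
        simp [extendAbs, abs_withSign]
      simp only [between, lower, upper, abs_withSign, he]
    rw [branch, branch, hb]
    refine Finset.sum_congr rfl fun mu _ => ?_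
    have hs : lastSgn (withSign (-1) lam) = -lastSgn lam := by
      simp only [lastSgn, withSign_last]
      rw [← sgn_neg h0]
      simp
    simp only [abs_withSign]
    rw [inv_zpow', hs]
    congr 2
    ring

/-- A form of the branching coefficient with a sign-independent dependence on `mu`. -/
theorem branch_eq_sum {k : ℤ} {p : ℕ} {lam : Fin (p + 2) → ℤ} {nu : Fin (p + 1) → ℤ}
    (hl : ∀ i, Even (lam i - k)) (hn : ∀ i, Even (nu i - k)) (q : Rˣ) :
    branch k lam nu q = ∑ mu ∈ between k lam nu,
      ((q ^ (∑ i : Fin (p + 1), |lam i.castSucc| + ∑ j : Fin p, |nu j.castSucc| +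
        |nu (Fin.last p) + lam (Fin.last (p + 1))| - 2 * ∑ j, mu j) : Rˣ) : R) := by
  -- With equal signs the absolute value is additive; with opposite signs it drops by twice the
  -- minimum, which is exactly the correction produced by reflecting mu.
  have hσ : lastSgn lam * lastSgn nu = 1 ∧
        |nu (Fin.last p) + lam (Fin.last (p + 1))| =
          |nu (Fin.last p)| + |lam (Fin.last (p + 1))| ∨
      lastSgn lam * lastSgn nu = -1 ∧
        |nu (Fin.last p) + lam (Fin.last (p + 1))| =
          |nu (Fin.last p)| + |lam (Fin.last (p + 1))|
            - 2 * min |lam (Fin.last (p + 1))| |nu (Fin.last p)| := by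
    simp only [lastSgn]
    generalize lam (Fin.last (p + 1)) = a
    generalize nu (Fin.last p) = b
    simp only [sgn]
    rcases le_or_gt 0 a with ha | ha <;> rcases le_or_gt 0 b with hb | hb
    · left
      simp only [ha, hb, if_true]
      constructor
      · rfl
      · rw [abs_of_nonneg ha, abs_of_nonneg hb, abs_of_nonneg (by omega)]
    · right
      simp only [ha, not_le.2 hb, if_true, if_false]
      constructor
      · rfl
      · rw [abs_of_nonneg ha, abs_of_neg hb]
        rcases abs_cases (b + a) with h | h <;> rcases min_cases a (-b) with h' | h' <;> omega
    · right
      simp only [hb, not_le.2 ha, if_true, if_false]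
      constructor
      · rfl
      · rw [abs_of_nonneg hb, abs_of_neg ha]
        rcases abs_cases (b + a) with h | h <;> rcases min_cases (-a) b with h' | h' <;> omega
    · left
      simp only [not_le.2 ha, not_le.2 hb, if_false]
      constructor
      · rfl
      · rw [abs_of_neg ha, abs_of_neg hb, abs_of_neg (by omega)]
        ring
  have he : extendAbs lam nu (Fin.last (p + 1)) = |nu (Fin.last p)| := by
    rw [← Fin.succ_last]
    simp [extendAbs]
  rw [branch]
  rcases hσ with ⟨h1, h2⟩ | ⟨h1, h2⟩
  · refine Finset.sum_congr rfl fun mu _ => ?_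
    rw [h1, h2, Fin.sum_univ_castSucc fun i => |lam i|, Fin.sum_univ_castSucc fun i => |nu i|]
    congr 2
    ring
  · rw [sum_between_reflect hl hn fun t => ((q ^ (lastSgn lam * lastSgn nu *
        (∑ i, |lam i| + ∑ j, |nu j| - 2 * t)) : Rˣ) : R)]
    refine Finset.sum_congr rfl fun mu _ => ?_
    rw [h1, h2, he, Fin.sum_univ_castSucc fun i => |lam i|, Fin.sum_univ_castSucc fun i => |nu i|]
    congr 2
    ring

/-! ### Determinant identities -/

open Matrix in
theorem sum_det_columns {n : ℕ} (s : Fin n → Finset ℤ) (H : Fin n → Fin n → ℤ → R) :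
    ∑ x ∈ Fintype.piFinset s, det (of fun i j => H i j (x j)) =
      det (of fun i j => ∑ t ∈ s j, H i j t) := by
  simp only [det_apply', of_apply, Finset.prod_univ_sum]
  rw [Finset.sum_comm]
  simp only [Finset.mul_sum]

open Matrix in
theorem sum_det_columns_snoc {n : ℕ} (s : Fin n → Finset ℤ) (H : Fin (n + 1) → Fin n → ℤ → R)
    (Q : Fin (n + 1) → R) :
    ∑ x ∈ Fintype.piFinset s,
        det (of fun i => (Fin.snoc (fun j => H i j (x j)) (Q i) : Fin (n + 1) → R)) =
      det (of fun i => (Fin.snoc (fun j => ∑ t ∈ s j, H i j t) (Q i) : Fin (n + 1) → R)) := by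
  simp only [det_apply', of_apply, Fin.prod_univ_castSucc, Fin.snoc_castSucc, Fin.snoc_last,
    Finset.prod_univ_sum]
  rw [Finset.sum_comm]
  simp only [Finset.mul_sum, Finset.sum_mul]

theorem det_eq_of_forall_col_eq_smul_add_succ {n : ℕ}
    {A B : Matrix (Fin (n + 1)) (Fin (n + 1)) R} (c : Fin n → R)
    (hlast : ∀ i, A i (Fin.last n) = B i (Fin.last n))
    (h : ∀ i (j : Fin n), A i j.castSucc = B i j.castSucc + c j * A i j.succ) :
    A.det = B.det := by
  rw [← Matrix.det_submatrix_equiv_self Fin.revPerm A,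
    ← Matrix.det_submatrix_equiv_self Fin.revPerm B]
  refine Matrix.det_eq_of_forall_col_eq_smul_add_pred (fun j => c j.rev) (fun i => ?_)
    fun i j => ?_
  · simpa using hlast i.rev
  · simpa [Fin.rev_succ, Fin.rev_castSucc] using h i.rev j.rev

-- Summing over nu leaves columns that are differences of neighbours, so each depends on two entries
-- of mu. Bordering by a row of ones undoes the differences: each column then depends on one entry,
-- and the sum over mu can again be taken columnwise.
open Matrix in
theorem det_border {p : ℕ} (P : Fin (p + 1) → Fin (p + 1) → R) (Q : Fin (p + 1) → R) (F : R) :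
    det (of fun i => (Fin.snoc (fun j : Fin p => P i j.castSucc - P i j.succ)
        (F * P i (Fin.last p) - Q i) : Fin (p + 1) → R)) =
      det (of fun i : Fin (p + 2) => (Fin.snoc
        (fun j => (Fin.snoc (fun i => P i j) 1 : Fin (p + 2) → R) i)
        ((Fin.snoc Q F : Fin (p + 2) → R) i) : Fin (p + 2) → R)) := by
  let B : Matrix (Fin (p + 2)) (Fin (p + 2)) R := of fun i => Fin.snoc (α := fun _ => R)
    (Fin.snoc (α := fun _ => R)
      (fun j : Fin p => (Fin.snoc (fun i => P i j.castSucc - P i j.succ) 0 : Fin (p + 2) → R) i)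
      ((Fin.snoc (fun i => P i (Fin.last p)) 1 : Fin (p + 2) → R) i))
    ((Fin.snoc (fun i => F * P i (Fin.last p) - Q i) 0 : Fin (p + 2) → R) i)
  let C : Matrix (Fin (p + 2)) (Fin (p + 2)) R := of fun i => Fin.snoc (α := fun _ => R)
    (Fin.snoc (α := fun _ => R)
      (fun j : Fin p => (Fin.snoc (fun i => P i j.castSucc - P i j.succ) 0 : Fin (p + 2) → R) i)
      ((Fin.snoc (fun i => P i (Fin.last p)) 1 : Fin (p + 2) → R) i))
    ((Fin.snoc Q F : Fin (p + 2) → R) i)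
  have h1 : det (of fun i : Fin (p + 2) => (Fin.snoc
        (fun j => (Fin.snoc (fun i => P i j) 1 : Fin (p + 2) → R) i)
        ((Fin.snoc Q F : Fin (p + 2) → R) i) : Fin (p + 2) → R)) = det C := by
    refine det_eq_of_forall_col_eq_smul_add_succ
      (Fin.snoc (fun _ => 1) 0 : Fin (p + 1) → R) (fun i => ?_) fun i j => ?_
    · simp [C]
    · refine Fin.lastCases ?_ (fun j => ?_) j
      · simp [C]
      · rw [Fin.succ_castSucc]
        simp only [C, of_apply, Fin.snoc_castSucc, one_mul]
        refine Fin.lastCases ?_ (fun i => ?_) i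
        · simp
        · simp
  -- Negate the last column of B, then add F times the column before it.
  have h2 : det C = -det B := by
    let v : Fin (p + 2) → R := Fin.snoc (fun _ => 1) (-1)
    have hv : det (of fun i j => v j * B i j) = (∏ j, v j) * det B := det_mul_row v B
    have hv' : ∏ j, v j = -1 := by simp [v, Fin.prod_univ_castSucc]
    rw [hv', neg_one_mul] at hv
    rw [← hv, ← det_transpose, ← det_transpose (of fun i j => v j * B i j)]
    refine det_eq_of_forall_row_eq_smul_add_const
      (Fin.snoc (fun _ => 0) F : Fin (p + 2) → R) (Fin.last p).castSucc (by simp) fun j i => ?_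
    simp only [transpose_apply, of_apply]
    refine Fin.lastCases ?_ (fun j => ?_) j
    · refine Fin.lastCases ?_ (fun i => ?_) i
      · simp [B, C, v]
      · simp [B, C, v]
    · simp [B, C, v]
  -- The last row of B has a single nonzero entry, the 1 in the last column but one; its cofactor
  -- sign -1 cancels the sign from `h2`.
  rw [h1, h2, det_succ_row B (Fin.last _),
    Finset.sum_eq_single (Fin.last p).castSucc]
  · have hs : ((-1 : R)) ^ ((Fin.last (p + 1) : ℕ) + ((Fin.last p).castSucc : ℕ)) = -1 := by
      simp only [Fin.val_last, Fin.val_castSucc]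
      exact Odd.neg_one_pow ⟨p, by ring⟩
    have hB : B (Fin.last (p + 1)) (Fin.last p).castSucc = 1 := by simp [B]
    rw [hs, hB, mul_one, neg_one_mul, neg_neg]
    congr 1
    ext i j
    simp only [submatrix_apply, Fin.succAbove_last]
    refine Fin.lastCases ?_ (fun j => ?_) j
    · rw [Fin.succAbove_castSucc_self, Fin.succ_last]
      simp [B]
    · rw [Fin.succAbove_castSucc_of_lt _ _ (Fin.castSucc_lt_last j)]
      simp [B]
  · intro j _ hj
    have : B (Fin.last (p + 1)) j = 0 := by
      revert hj
      refine Fin.lastCases ?_ (fun j => ?_) j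
      · simp [B]
      · refine Fin.lastCases ?_ (fun j => ?_) j
        · simp
        · simp [B]
    rw [this]
    simp
  · simp

/-! ### Telescoping sums of two-term functions -/

theorem val_zpow_add (q : Rˣ) (a b : ℤ) :
    ((q ^ (a + b) : Rˣ) : R) = ((q ^ a : Rˣ) : R) * ((q ^ b : Rˣ) : R) := by
  rw [zpow_add, Units.val_mul]

theorem prod_val_zpow {ι : Type*} (s : Finset ι) (q : Rˣ) (a : ι → ℤ) :
    ∏ j ∈ s, ((q ^ a j : Rˣ) : R) = ((q ^ (∑ j ∈ s, a j) : Rˣ) : R) := by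
  classical
  induction s using Finset.induction_on with
  | empty => simp
  | insert j s hj ih => rw [Finset.prod_insert hj, Finset.sum_insert hj, ih, val_zpow_add]

/-- The function `a ^ k + s * a ^ (-k)`. -/
def twoTerm (s : R) (a : Rˣ) (k : ℤ) : R := ((a ^ k : Rˣ) : R) + s * ((a ^ (-k) : Rˣ) : R)

theorem twoTerm_neg {s : R} (hs : s * s = 1) (a : Rˣ) (k : ℤ) :
    twoTerm s a (-k) = s * twoTerm s a k := by
  simp only [twoTerm, neg_neg]
  linear_combination (-((a ^ (-k) : Rˣ) : R)) * hs

/-- The function `x + x⁻¹`, where `x = a ^ 2`. -/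
def trace (a : Rˣ) : R := ((a ^ (2 : ℤ) : Rˣ) : R) + ((a ^ (-2 : ℤ) : Rˣ) : R)

/-- Partial sums of `q ^ k * (trace a - trace q) * twoTerm s a k`. -/
def partialSum (s : R) (a q : Rˣ) (m : ℤ) : R :=
  ((q ^ m : Rˣ) : R) * (twoTerm s a (m + 2) - ((q ^ (2 : ℤ) : Rˣ) : R) * twoTerm s a m)

theorem zpow_two_mul_neg (q : Rˣ) :
    ((q ^ (2 : ℤ) : Rˣ) : R) * ((q ^ (-2 : ℤ) : Rˣ) : R) = 1 := by
  rw [← val_zpow_add]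
  simp

/-- The recurrence twoTerm (m + 2) + twoTerm (m - 2) = trace a * twoTerm m shows that the factor
trace a - trace q turns the summand into an exact difference. -/
theorem partialSum_sub (s : R) (a q : Rˣ) (m : ℤ) :
    partialSum s a q m - partialSum s a q (m - 2) =
      ((q ^ m : Rˣ) : R) * ((trace a - trace q) * twoTerm s a m) := by
  have h1 : ((q ^ (m - 2) : Rˣ) : R) = ((q ^ m : Rˣ) : R) * ((q ^ (-2 : ℤ) : Rˣ) : R) := by
    rw [← val_zpow_add, sub_eq_add_neg]
  have h2 : twoTerm s a (m + 2) + twoTerm s a (m - 2) = trace a * twoTerm s a m := by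
    simp only [twoTerm, trace]
    rw [show -(m + 2) = -m + -2 by ring, show -(m - 2) = -m + 2 by ring,
      show m - 2 = m + -2 by ring]
    simp only [val_zpow_add]
    ring
  simp only [partialSum, h1, sub_add_cancel]
  rw [sub_mul, ← h2]
  simp only [trace]
  linear_combination (((q ^ m : Rˣ) : R) * twoTerm s a (m - 2)) * zpow_two_mul_neg q

theorem sum_zpow_mul_twoTerm (s : R) (a q : Rˣ) {k x y : ℤ} (hx : Even (x - k))
    (hy : Even (y - k)) (hxy : x ≤ y + 2) (c : ℤ) :
    ∑ t ∈ parityIcc k x y, ((q ^ t : Rˣ) : R) * ((trace a - trace q) * twoTerm s a (t + c)) =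
      ((q ^ (-c) : Rˣ) : R) * (partialSum s a q (y + c) - partialSum s a q (x + c - 2)) := by
  have h := sum_parityIcc_telescope
    (fun t => ((q ^ (-c) : Rˣ) : R) * partialSum s a q (t + c - 2)) hx hy hxy
  rw [mul_sub, show y + c = y + 2 + c - 2 by ring, ← h]
  refine Finset.sum_congr rfl fun t _ => ?_
  rw [← mul_sub, show t + 2 + c - 2 = t + c by ring, partialSum_sub,
    ← mul_assoc ((q ^ (-c) : Rˣ) : R), ← val_zpow_add, neg_add_cancel_comm_assoc]

/-- The constant that glues the two antiderivatives of q ^ |t + l| * twoTerm s a t, up to the factor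
trace a - trace q, at the kink t = -l. -/
theorem partialSum_boundary {s : R} (hs : s * s = 1) (a q : Rˣ) (l : ℤ) :
    ((q ^ l : Rˣ) : R) * partialSum s a q (-l - 2) +
        s * (((q ^ (-l) : Rˣ) : R) * partialSum s a q l) =
      s * (((q ^ (-2 : ℤ) : Rˣ) : R) - ((q ^ (2 : ℤ) : Rˣ) : R)) * twoTerm s a l := by
  have h1 : ((q ^ l : Rˣ) : R) * ((q ^ (-l) : Rˣ) : R) = 1 := by
    rw [← val_zpow_add]
    simp
  simp only [partialSum]
  rw [show -l - 2 + 2 = -l by ring, show -l - 2 = -(l + 2) by ring, twoTerm_neg hs, twoTerm_neg hs,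
    show -(l + 2) = -l + -2 by ring, val_zpow_add]
  linear_combination (s * (((q ^ (-2 : ℤ) : Rˣ) : R) * twoTerm s a l
    - ((q ^ (2 : ℤ) : Rˣ) : R) * ((q ^ (-2 : ℤ) : Rˣ) : R) * twoTerm s a (l + 2)
    + twoTerm s a (l + 2) - ((q ^ (2 : ℤ) : Rˣ) : R) * twoTerm s a l)) * h1
    + (-s * twoTerm s a (l + 2)) * zpow_two_mul_neg q

theorem sum_zpow_abs_mul_twoTerm {s : R} (hs : s * s = 1) (a q : Rˣ) {k l y : ℤ}
    (hl : Even (l - k)) (hy : Even (y - k)) (hly : |l| ≤ y) :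
    ∑ t ∈ parityIcc k (-y) y, ((q ^ |t + l| : Rˣ) : R) * ((trace a - trace q) * twoTerm s a t) =
      twoTerm s q l * partialSum s a q y -
        s * (((q ^ (-2 : ℤ) : Rˣ) : R) - ((q ^ (2 : ℤ) : Rˣ) : R)) * twoTerm s a l := by
  obtain ⟨hl1, hl2⟩ := abs_le.1 hly
  -- Right of the kink `partialSum` is used directly, left of it after t ↦ -t, which costs the
  -- factor s. The added constant makes both formulas agree at t = -l.
  let G : ℤ → R := fun t =>
    if t ≤ -l then
      -(s * (((q ^ (-l) : Rˣ) : R) * partialSum s a q (-t))) +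
        (((q ^ l : Rˣ) : R) * partialSum s a q (-l - 2) +
          s * (((q ^ (-l) : Rˣ) : R) * partialSum s a q l))
    else ((q ^ l : Rˣ) : R) * partialSum s a q (t - 2)
  have hny : Even (-y - k) := by
    obtain ⟨x, hx⟩ := hy
    exact ⟨-x - k, by omega⟩
  have h := sum_parityIcc_telescope G hny hy (by have := abs_nonneg l; omega)
  have e1 : G (y + 2) = ((q ^ l : Rˣ) : R) * partialSum s a q y := by
    simp only [G]
    rw [if_neg (by omega), add_sub_cancel_right]
  have e2 : G (-y) = -(s * (((q ^ (-l) : Rˣ) : R) * partialSum s a q y)) +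
        s * (((q ^ (-2 : ℤ) : Rˣ) : R) - ((q ^ (2 : ℤ) : Rˣ) : R)) * twoTerm s a l := by
    simp only [G]
    rw [if_pos (by omega), neg_neg, partialSum_boundary hs]
  calc _ = ∑ t ∈ parityIcc k (-y) y, (G (t + 2) - G t) := by
        refine Finset.sum_congr rfl fun t ht => ?_
        rw [mem_parityIcc] at ht
        obtain ⟨-, ⟨x, hx⟩⟩ := ht
        obtain ⟨w, hw⟩ := hl
        rcases lt_or_ge t (-l) with htl | htl
        · simp only [G]
          rw [if_pos (by omega), if_pos (by omega), abs_of_neg (by omega)]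
          have := partialSum_sub s a q (-t)
          rw [twoTerm_neg hs] at this
          rw [show -(t + 2) = -t - 2 by ring, show -(t + l) = -l + -t by ring, val_zpow_add]
          linear_combination (-(s * ((q ^ (-l) : Rˣ) : R))) * this
            - ((q ^ (-l) : Rˣ) : R) * ((q ^ (-t) : Rˣ) : R) * ((trace a - trace q) * twoTerm s a t)
              * hs
        · have e3 : G t = ((q ^ l : Rˣ) : R) * partialSum s a q (t - 2) := by
            simp only [G]
            split_ifs with h'
            · have : t = -l := by omega
              subst this
              rw [neg_neg]
              ring
            · rfl
          rw [e3]
          simp only [G]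
          rw [if_neg (by omega), add_sub_cancel_right, ← mul_sub, partialSum_sub,
            abs_of_nonneg (by omega), add_comm t l, val_zpow_add, mul_assoc]
    _ = _ := by
        have e3 : twoTerm s q l = ((q ^ l : Rˣ) : R) + s * ((q ^ (-l) : Rˣ) : R) := rfl
        rw [h, e1, e2, e3]
        ring

/-! ### The branching rule for alternants -/

/-- The alternants in the numerators of the Weyl character formula. -/
noncomputable def alternant (s : R) {n : ℕ} (lam : Fin n → ℤ) (r : Fin n → Rˣ) : R :=
  (Matrix.of fun i j : Fin n => twoTerm s (r i) (lam j + 2 * ((n : ℤ) - 1 - (j : ℕ)))).det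

theorem abs_le_of_adjacent {n : ℕ} {nu : Fin (n + 1) → ℤ}
    (h : ∀ j : Fin n, |nu j.succ| ≤ nu j.castSucc) {i j : Fin (n + 1)} (hij : i < j) :
    |nu j| ≤ nu i := by
  have hanti : Antitone fun i => |nu i| :=
    Fin.antitone_iff_succ_le.2 fun j => (h j).trans (le_abs_self _)
  obtain ⟨i, rfl⟩ := Fin.exists_castSucc_eq.2 (hij.trans_le (Fin.le_last j)).ne
  exact (hanti (Fin.castSucc_lt_iff_succ_le.1 hij)).trans (h i)

theorem mem_between {k : ℤ} {n : ℕ} {lam : Fin (n + 1) → ℤ} {nu mu : Fin n → ℤ} :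
    mu ∈ between k lam nu ↔ ∀ j, (|lam j.succ| ≤ mu j ∧ |nu j| ≤ mu j ∧ mu j ≤ |lam j.castSucc| ∧
      mu j ≤ extendAbs lam nu j.castSucc) ∧ Even (mu j - k) := by
  simp [between, mem_parityIcc, lower, upper, and_assoc]

theorem extendAbs_castSucc_succ {p : ℕ} (lam : Fin (p + 2) → ℤ) (nu : Fin (p + 1) → ℤ)
    (j : Fin p) : extendAbs lam nu j.succ.castSucc = |nu j.castSucc| := by
  rw [← Fin.succ_castSucc]
  simp [extendAbs]

theorem extendAbs_castSucc_zero {p : ℕ} (lam : Fin (p + 2) → ℤ) (nu : Fin (p + 1) → ℤ) :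
    extendAbs lam nu (0 : Fin (p + 1)).castSucc = |lam 0| := by
  simp [extendAbs]

/-- Interlacing, read from the row in the middle. -/
theorem interlacing_iff {k p : ℕ} {lam : Fin (p + 2) → ℤ}
    (hlam : lam ∈ signedPartitionsIn (p + 2) k) (nu mu : Fin (p + 1) → ℤ) :
    nu ∈ signedPartitionsIn (p + 1) k ∧ mu ∈ between k lam nu ↔
      nu ∈ Fintype.piFinset (fun j => parityIcc k
          ((Fin.snoc (fun j => mu j.succ) (-mu (Fin.last p)) : Fin (p + 1) → ℤ) j) (mu j)) ∧
        mu ∈ Fintype.piFinset fun j => parityIcc k |lam j.succ| (lam j.castSucc) := by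
  have habs := abs_of_mem_signedPartitionsIn hlam
  have hlam' := mem_signedPartitionsIn.1 hlam
  -- For fixed mu the conditions on nu decouple into a box: nu_j lies in [mu_(j+1), mu_j], and the
  -- last entry, which may be negative, in [-mu_p, mu_p].
  rw [mem_between, Fintype.mem_piFinset, Fintype.mem_piFinset]
  simp only [mem_parityIcc]
  constructor
  · rintro ⟨hnu, hmu⟩
    have hnu' := mem_signedPartitionsIn.1 hnu
    refine ⟨fun j => ⟨⟨?_, ?_⟩, hnu'.2.1 j⟩, fun j => ⟨⟨(hmu j).1.1, ?_⟩, (hmu j).2⟩⟩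
    · refine Fin.lastCases ?_ (fun j => ?_) j
      · rw [Fin.snoc_last]
        exact (abs_le.1 (hmu (Fin.last p)).1.2.1).1
      · rw [Fin.snoc_castSucc]
        have := (hmu j.succ).1.2.2.2
        rwa [extendAbs_castSucc_succ, abs_of_mem_signedPartitionsIn hnu] at this
    · exact (le_abs_self _).trans (hmu j).1.2.1
    · rw [← habs]
      exact (hmu j).1.2.2.1
  · rintro ⟨hnu, hmu⟩
    have h0 : ∀ j, 0 ≤ mu j := fun j => (abs_nonneg _).trans (hmu j).1.1
    have hc : ∀ j : Fin p, mu j.succ ≤ nu j.castSucc := fun j => by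
      simpa using (hnu j.castSucc).1.1
    have hl : ∀ j, |nu j| ≤ mu j := by
      intro j
      refine Fin.lastCases ?_ (fun j => ?_) j
      · have := (hnu (Fin.last p)).1
        rw [Fin.snoc_last] at this
        exact abs_le.2 this
      · rw [abs_of_nonneg ((h0 _).trans (hc j))]
        exact (hnu j.castSucc).1.2
    refine ⟨mem_signedPartitionsIn.2 ⟨fun j => ?_, fun j => (hnu j).2, fun i j hij =>
      abs_le_of_adjacent (fun j => (hl _).trans (hc j)) hij⟩,
      fun j => ⟨⟨(hmu j).1.1, hl j, ?_, ?_⟩, (hmu j).2⟩⟩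
    · exact (hl j).trans ((hmu j).1.2.trans ((le_abs_self _).trans (hlam'.1 _)))
    · rw [habs]
      exact (hmu j).1.2
    · refine Fin.cases ?_ (fun j => ?_) j
      · rw [extendAbs_castSucc_zero]
        exact (hmu 0).1.2.trans (le_abs_self _)
      · rw [extendAbs_castSucc_succ]
        exact (hc j).trans (le_abs_self _)

open Matrix in
/-- The sum over the lower of two interlacing rows. -/
theorem sum_lower_row {s : R} (hs : s * s = 1) {k p : ℕ} {lam : Fin (p + 2) → ℤ}
    (hlam : lam ∈ signedPartitionsIn (p + 2) k) (r : Fin (p + 1) → Rˣ) (q : Rˣ)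
    {mu : Fin (p + 1) → ℤ}
    (hmu : mu ∈ Fintype.piFinset fun j => parityIcc k |lam j.succ| (lam j.castSucc)) :
    ∑ nu ∈ Fintype.piFinset (fun j => parityIcc k
        ((Fin.snoc (fun j => mu j.succ) (-mu (Fin.last p)) : Fin (p + 1) → ℤ) j) (mu j)),
      ((q ^ (∑ j : Fin p, |nu j.castSucc| + |nu (Fin.last p) + lam (Fin.last (p + 1))|) : Rˣ) : R) *
        (alternant s nu r * ∏ i, (trace (r i) - trace q)) =
    (∏ j : Fin (p + 1), ((q ^ (-(2 * ((p : ℤ) - (j : ℕ)))) : Rˣ) : R)) *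
      det (of fun i => (Fin.snoc
        (fun j : Fin (p + 1) => (Fin.snoc
          (fun i => partialSum s (r i) q (mu j + 2 * ((p : ℤ) - (j : ℕ)))) 1 : Fin (p + 2) → R) i)
        ((Fin.snoc (fun i => s * (((q ^ (-2 : ℤ) : Rˣ) : R) - ((q ^ (2 : ℤ) : Rˣ) : R)) *
            twoTerm s (r i) (lam (Fin.last (p + 1))))
          (twoTerm s q (lam (Fin.last (p + 1)))) : Fin (p + 2) → R) i) : Fin (p + 2) → R)) := by
  have hlam' := (mem_signedPartitionsIn.1 hlam).2.1
  simp only [Fintype.mem_piFinset, mem_parityIcc] at hmu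
  have h0 : ∀ j, 0 ≤ mu j := fun j => (abs_nonneg _).trans (hmu j).1.1
  -- In unbordered form the columns are the telescoped sums over the single entries of nu.
  rw [← det_border]
  let e : Fin (p + 1) → ℤ → ℤ := fun j t =>
    (Fin.snoc (fun _ => t) |t + lam (Fin.last (p + 1))| : Fin (p + 1) → ℤ) j
  let c : Fin (p + 1) → ℤ := fun j => 2 * ((p : ℤ) - (j : ℕ))
  let H : Fin (p + 1) → Fin (p + 1) → ℤ → R := fun i j t =>
    ((q ^ e j t : Rˣ) : R) * ((trace (r i) - trace q) * twoTerm s (r i) (t + c j))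
  have h1 : ∀ nu ∈ Fintype.piFinset (fun j => parityIcc k
        ((Fin.snoc (fun j => mu j.succ) (-mu (Fin.last p)) : Fin (p + 1) → ℤ) j) (mu j)),
      ((q ^ (∑ j : Fin p, |nu j.castSucc| + |nu (Fin.last p) + lam (Fin.last (p + 1))|) : Rˣ) : R) *
        (alternant s nu r * ∏ i, (trace (r i) - trace q)) = det (of fun i j => H i j (nu j)) := by
    intro nu hnu
    simp only [Fintype.mem_piFinset, mem_parityIcc] at hnu
    have hn : ∀ j : Fin p, |nu j.castSucc| = nu j.castSucc := fun j => by
      have := (hnu j.castSucc).1.1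
      rw [Fin.snoc_castSucc] at this
      exact abs_of_nonneg ((h0 _).trans this)
    have ha : alternant s nu r = det (of fun i j => twoTerm s (r i) (nu j + c j)) := by
      unfold alternant
      congr 1
      ext i j
      simp only [of_apply, c]
      congr 2
      push_cast
      ring
    have hp : ((q ^ (∑ j : Fin p, |nu j.castSucc| + |nu (Fin.last p) + lam (Fin.last (p + 1))|) :
        Rˣ) : R) = ∏ j, ((q ^ e j (nu j) : Rˣ) : R) := by
      rw [prod_val_zpow, Fin.sum_univ_castSucc]
      simp only [e, Fin.snoc_castSucc, Fin.snoc_last, hn]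
    have e1 := det_mul_column (fun i => trace (r i) - trace q)
      (of fun i j => twoTerm s (r i) (nu j + c j))
    have e2 := det_mul_row (fun j => ((q ^ e j (nu j) : Rˣ) : R))
      (of fun i j => (trace (r i) - trace q) * twoTerm s (r i) (nu j + c j))
    simp only [of_apply] at e1 e2
    rw [ha, hp, mul_comm (det _), ← e1, ← e2]
  rw [Finset.sum_congr rfl h1, sum_det_columns, ← det_mul_row]
  congr 1
  ext i j
  simp only [of_apply]
  refine Fin.lastCases ?_ (fun j => ?_) j
  · have h := sum_zpow_abs_mul_twoTerm hs (r i) q (hlam' (Fin.last (p + 1)))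
      (hmu (Fin.last p)).2 (hmu (Fin.last p)).1.1
    simp only [Fin.snoc_last, H, e, c, Fin.val_last, sub_self, mul_zero, add_zero, neg_zero,
      zpow_zero, Units.val_one, one_mul]
    exact h
  · have hle : mu j.succ ≤ mu j.castSucc + 2 := by
      have h2 := (hmu j.succ).1.2
      have h3 := (hmu j.castSucc).1.1
      have h4 := abs_of_mem_signedPartitionsIn hlam j.succ
      rw [← Fin.succ_castSucc] at h2 h4
      omega
    have h := sum_zpow_mul_twoTerm s (r i) q (hmu j.succ).2 (hmu j.castSucc).2 hle (c j.castSucc)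
    simp only [Fin.snoc_castSucc, H, e]
    rw [h]
    -- The shift c drops by 2 from one column to the next, so the lower boundary term of column j is
    -- the upper one of column j + 1.
    have : mu j.succ + c j.castSucc - 2 = mu j.succ + 2 * ((p : ℤ) - ((j.succ : Fin (p + 1)) : ℕ)) := by
      simp only [c, Fin.val_castSucc, Fin.val_succ]
      push_cast
      ring
    rw [this]

theorem sum_zpow_neg_mul_partialSum (s : R) (a q : Rˣ) {k x y : ℤ} (hx : Even (x - k))
    (hy : Even (y - k)) (hxy : x ≤ y + 2) (c : ℤ) :
    ∑ t ∈ parityIcc k x y, ((q ^ (-(2 * t)) : Rˣ) : R) * partialSum s a q (t + c) =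
      ((q ^ (2 * c + 2) : Rˣ) : R) *
        (((q ^ (-(y + c + 2)) : Rˣ) : R) * twoTerm s a (y + c + 2) -
          ((q ^ (-(x + c)) : Rˣ) : R) * twoTerm s a (x + c)) := by
  have h := sum_parityIcc_telescope
    (fun t => ((q ^ (-(t + c)) : Rˣ) : R) * twoTerm s a (t + c)) hx hy hxy
  rw [show y + c + 2 = y + 2 + c by ring, ← h, Finset.mul_sum]
  refine Finset.sum_congr rfl fun t _ => ?_
  have h1 : ((q ^ (-(2 * t)) : Rˣ) : R) * ((q ^ (t + c) : Rˣ) : R) =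
      ((q ^ (2 * c + 2) : Rˣ) : R) * ((q ^ (-(t + 2 + c)) : Rˣ) : R) := by
    rw [← val_zpow_add, ← val_zpow_add]
    congr 2
    ring
  have h2 : ((q ^ (-(2 * t)) : Rˣ) : R) * ((q ^ (t + c) : Rˣ) : R) * ((q ^ (2 : ℤ) : Rˣ) : R) =
      ((q ^ (2 * c + 2) : Rˣ) : R) * ((q ^ (-(t + c)) : Rˣ) : R) := by
    rw [← val_zpow_add, ← val_zpow_add, ← val_zpow_add]
    congr 2
    ring
  rw [partialSum, show t + c + 2 = t + 2 + c by ring]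
  linear_combination twoTerm s a (t + 2 + c) * h1 - twoTerm s a (t + c) * h2

/-- The analogue of `sum_zpow_neg_mul_partialSum` for the bordering row of ones: after scaling it
becomes the row of the variable q itself, which is how the missing row of the larger alternant
appears. -/
theorem sum_zpow_neg (s : R) (q : Rˣ) {k x y : ℤ} (hx : Even (x - k))
    (hy : Even (y - k)) (hxy : x ≤ y + 2) (c : ℤ) :
    s * (((q ^ (-2 : ℤ) : Rˣ) : R) - ((q ^ (2 : ℤ) : Rˣ) : R)) *
        ∑ t ∈ parityIcc k x y, ((q ^ (-(2 * t)) : Rˣ) : R) =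
      ((q ^ (2 * c + 2) : Rˣ) : R) *
        (((q ^ (-(y + c + 2)) : Rˣ) : R) * twoTerm s q (y + c + 2) -
          ((q ^ (-(x + c)) : Rˣ) : R) * twoTerm s q (x + c)) := by
  have h := sum_parityIcc_telescope
    (fun t => ((q ^ (-(t + c)) : Rˣ) : R) * twoTerm s q (t + c)) hx hy hxy
  rw [show y + c + 2 = y + 2 + c by ring, ← h, Finset.mul_sum, Finset.mul_sum]
  refine Finset.sum_congr rfl fun t _ => ?_
  have key : ∀ l : ℤ, ((q ^ (-l) : Rˣ) : R) * twoTerm s q l = 1 + s * ((q ^ (-(2 * l)) : Rˣ) : R) := by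
    intro l
    rw [twoTerm, mul_add, ← val_zpow_add, mul_left_comm, ← val_zpow_add]
    congr 1
    · simp
    · ring_nf
  have h1 : ((q ^ (-2 : ℤ) : Rˣ) : R) * ((q ^ (-(2 * t)) : Rˣ) : R) =
      ((q ^ (2 * c + 2) : Rˣ) : R) * ((q ^ (-(2 * (t + 2 + c))) : Rˣ) : R) := by
    rw [← val_zpow_add, ← val_zpow_add]
    congr 2
    ring
  have h2 : ((q ^ (2 : ℤ) : Rˣ) : R) * ((q ^ (-(2 * t)) : Rˣ) : R) =
      ((q ^ (2 * c + 2) : Rˣ) : R) * ((q ^ (-(2 * (t + c))) : Rˣ) : R) := by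
    rw [← val_zpow_add, ← val_zpow_add]
    congr 2
    ring
  rw [key, key]
  linear_combination s * h1 - s * h2

open Matrix in
/-- The branching rule for the numerators of the Weyl character formula. -/
theorem sum_branch_mul_alternant [IsDomain R] {s : R} (hs : s * s = 1) {k p : ℕ}
    {lam : Fin (p + 2) → ℤ} (hlam : lam ∈ signedPartitionsIn (p + 2) k) (r : Fin (p + 2) → Rˣ)
    (hr : ((r (Fin.last _) ^ (-2 : ℤ) : Rˣ) : R) - ((r (Fin.last _) ^ (2 : ℤ) : Rˣ) : R) ≠ 0) :
    (∑ nu ∈ signedPartitionsIn (p + 1) k,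
        branch k lam nu (r (Fin.last _)) * alternant s nu fun i => r i.castSucc) *
      ∏ i : Fin (p + 1), (trace (r i.castSucc) - trace (r (Fin.last _))) = alternant s lam r := by
  have hlam' := (mem_signedPartitionsIn.1 hlam).2.1
  have habs := abs_of_mem_signedPartitionsIn hlam
  set q := r (Fin.last _) with hq
  set w : Fin (p + 1) → Rˣ := fun i => r i.castSucc with hw
  set κ : R := s * (((q ^ (-2 : ℤ) : Rˣ) : R) - ((q ^ (2 : ℤ) : Rˣ) : R)) with hκ
  have hκ0 : κ ≠ 0 := mul_ne_zero (left_ne_zero_of_mul_eq_one hs) hr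
  let c : Fin (p + 1) → ℤ := fun j => 2 * ((p : ℤ) - (j : ℕ))
  let A : ℤ := ∑ i : Fin (p + 1), lam i.castSucc
  let S := Fintype.piFinset fun j : Fin (p + 1) => parityIcc k |lam j.succ| (lam j.castSucc)
  let last : Fin (p + 2) → R := Fin.snoc
    (fun i => κ * twoTerm s (w i) (lam (Fin.last (p + 1)))) (twoTerm s q (lam (Fin.last (p + 1))))
  let H : Fin (p + 2) → Fin (p + 1) → ℤ → R := fun i j t =>
    ((q ^ (-(2 * t)) : Rˣ) : R) *
      (Fin.snoc (fun i => partialSum s (w i) q (t + c j)) 1 : Fin (p + 2) → R) i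
  -- sum over the lower row
  have step1 : (∑ nu ∈ signedPartitionsIn (p + 1) k, branch k lam nu q * alternant s nu w) *
      ∏ i : Fin (p + 1), (trace (w i) - trace q) =
      ((q ^ A : Rˣ) : R) * (∏ j, ((q ^ (-c j) : Rˣ) : R)) *
        ∑ mu ∈ S, det (of fun i => (Fin.snoc (fun j => H i j (mu j)) (last i) :
          Fin (p + 2) → R)) := by
    have e1 : (∑ nu ∈ signedPartitionsIn (p + 1) k, branch k lam nu q * alternant s nu w) *
        ∏ i : Fin (p + 1), (trace (w i) - trace q) =
        ∑ nu ∈ signedPartitionsIn (p + 1) k, ∑ mu ∈ between k lam nu,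
          ((q ^ (A - 2 * ∑ j, mu j) : Rˣ) : R) *
          (((q ^ (∑ j : Fin p, |nu j.castSucc| + |nu (Fin.last p) + lam (Fin.last (p + 1))|) :
            Rˣ) : R) * (alternant s nu w * ∏ i, (trace (w i) - trace q))) := by
      rw [Finset.sum_mul]
      refine Finset.sum_congr rfl fun nu hnu => ?_
      rw [branch_eq_sum hlam' (mem_signedPartitionsIn.1 hnu).2.1, Finset.sum_mul, Finset.sum_mul]
      refine Finset.sum_congr rfl fun mu _ => ?_
      simp only [habs]
      rw [mul_assoc, ← mul_assoc ((q ^ (A - 2 * ∑ j, mu j) : Rˣ) : R), ← val_zpow_add]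
      congr 3
      ring
    rw [e1, Finset.sum_comm' (fun nu mu => interlacing_iff hlam nu mu), Finset.mul_sum]
    refine Finset.sum_congr rfl fun mu hmu => ?_
    rw [← Finset.mul_sum, sum_lower_row hs hlam w q hmu]
    have hv := det_mul_row
      (Fin.snoc (fun j => ((q ^ (-(2 * mu j)) : Rˣ) : R)) 1 : Fin (p + 2) → R)
      (of fun i => (Fin.snoc
        (fun j : Fin (p + 1) => (Fin.snoc
          (fun i => partialSum s (w i) q (mu j + c j)) 1 : Fin (p + 2) → R) i)
        (last i) : Fin (p + 2) → R))
    rw [Fin.prod_univ_castSucc] at hv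
    simp only [Fin.snoc_castSucc, Fin.snoc_last, mul_one] at hv
    rw [prod_val_zpow, Finset.sum_neg_distrib, ← Finset.mul_sum] at hv
    rw [sub_eq_add_neg, val_zpow_add]
    have hH : (of fun i => (Fin.snoc (fun j => H i j (mu j)) (last i) : Fin (p + 2) → R)) =
        of fun i j => (Fin.snoc (fun j => ((q ^ (-(2 * mu j)) : Rˣ) : R)) 1 : Fin (p + 2) → R) j *
          (of fun i => (Fin.snoc
        (fun j : Fin (p + 1) => (Fin.snoc
          (fun i => partialSum s (w i) q (mu j + c j)) 1 : Fin (p + 2) → R) i)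
        (last i) : Fin (p + 2) → R)) i j := by
      ext i j
      refine Fin.lastCases ?_ (fun j => ?_) j
      · simp
      · simp [H]
    rw [hH, hv]
    simp only [c, last, hκ]
    ring
  -- sum over the middle row
  have step2 : κ * det (of fun i => (Fin.snoc
        (fun j => ∑ t ∈ parityIcc k |lam j.succ| (lam j.castSucc), H i j t) (last i) :
          Fin (p + 2) → R)) =
      κ * ((∏ j, ((q ^ (2 * c j + 2) : Rˣ) : R)) *
        ((∏ j : Fin (p + 1), ((q ^ (-(lam j.castSucc + c j + 2)) : Rˣ) : R)) *
          alternant s lam r)) := by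
    let l : Fin (p + 2) → ℤ := fun j => lam j + 2 * ((p : ℤ) + 1 - (j : ℕ))
    let V : Fin (p + 2) → ℤ → R := fun i l => ((q ^ (-l) : Rˣ) : R) * twoTerm s (r i) l
    have hl : ∀ j : Fin (p + 1), l j.castSucc = lam j.castSucc + c j + 2 := by
      intro j
      simp only [l, c, Fin.val_castSucc]
      ring
    have hl' : ∀ j : Fin p, l j.castSucc.succ = lam j.castSucc.succ + c j.castSucc := by
      intro j
      simp only [l, c, Fin.val_castSucc, Fin.val_succ]
      push_cast
      ring
    have hlast : l (Fin.last _) = lam (Fin.last _) := by simp [l]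
    -- The factor κ goes into the last row on this side and comes out of the last column in `e2`.
    have e1 := det_mul_column (Fin.snoc (fun _ => 1) κ : Fin (p + 2) → R)
      (of fun i => (Fin.snoc
        (fun j => ∑ t ∈ parityIcc k |lam j.succ| (lam j.castSucc), H i j t) (last i) :
          Fin (p + 2) → R))
    rw [Fin.prod_univ_castSucc] at e1
    simp only [Fin.snoc_castSucc, Fin.snoc_last, Finset.prod_const_one, one_mul] at e1
    have e2 := det_mul_row (Fin.snoc (fun j => ((q ^ (2 * c j + 2) : Rˣ) : R)) κ : Fin (p + 2) → R)
      (of fun i => (Fin.snoc (fun j => V i (lam j.castSucc + c j + 2) - V i (|lam j.succ| + c j))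
        (twoTerm s (r i) (lam (Fin.last _))) : Fin (p + 2) → R))
    rw [Fin.prod_univ_castSucc] at e2
    simp only [Fin.snoc_castSucc, Fin.snoc_last] at e2
    have e3 := det_mul_row
      (Fin.snoc (fun j => ((q ^ (-(lam j.castSucc + c j + 2)) : Rˣ) : R)) 1 : Fin (p + 2) → R)
      (of fun i j => twoTerm s (r i) (l j))
    rw [Fin.prod_univ_castSucc] at e3
    simp only [Fin.snoc_castSucc, Fin.snoc_last, mul_one] at e3
    have e4 : alternant s lam r = det (of fun i j => twoTerm s (r i) (l j)) := by
      unfold alternant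
      congr 1
      ext i j
      simp only [of_apply, l]
      congr 2
      push_cast
      ring
    rw [e4, ← e3, ← e1, ← mul_assoc, mul_comm κ (∏ j, _)]
    refine Eq.trans (congrArg det ?_) (e2.trans (congrArg _ ?_))
    · ext i j
      simp only [of_apply]
      refine Fin.lastCases ?_ (fun j => ?_) j
      · simp only [Fin.snoc_last]
        refine Fin.lastCases ?_ (fun i => ?_) i
        · simp [last, hq]
        · simp [last, hw]
      · simp only [Fin.snoc_castSucc]
        have hx : Even (|lam j.succ| - k) := even_abs_sub (hlam' _)
        have hy : Even (lam j.castSucc - k) := hlam' _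
        have hxy : |lam j.succ| ≤ lam j.castSucc + 2 := by
          have := (mem_signedPartitionsIn.1 hlam).2.2 j.castSucc j.succ Fin.castSucc_lt_succ
          omega
        refine Fin.lastCases ?_ (fun i => ?_) i
        · have := sum_zpow_neg s q hx hy hxy (c j)
          simpa [H, V, hκ, hq, -neg_add_rev] using this
        · have := sum_zpow_neg_mul_partialSum s (w i) q hx hy hxy (c j)
          simpa [H, V, hw, -neg_add_rev] using this
    · symm
      -- The last entry of lam may be negative while the sums start at its absolute value; by the
      -- parity of `twoTerm` this changes the column by a scalar only.
      obtain ⟨d, hd⟩ : ∃ d : R, ∀ i,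
          V i |lam (Fin.last _)| = d * twoTerm s (r i) (lam (Fin.last _)) := by
        rcases abs_choice (lam (Fin.last (p + 1))) with h | h <;> rw [h]
        · exact ⟨_, fun i => rfl⟩
        · refine ⟨((q ^ (lam (Fin.last (p + 1))) : Rˣ) : R) * s, fun i => ?_⟩
          simp only [V, neg_neg, twoTerm_neg hs]
          ring
      refine det_eq_of_forall_col_eq_smul_add_succ
        (Fin.snoc (fun _ => 1) d : Fin (p + 1) → R) (fun i => ?_) fun i j => ?_
      · simp [hlast]
      · refine Fin.lastCases ?_ (fun j => ?_) j
        · have hc : c (Fin.last p) = 0 := by simp [c]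
          have h1 := hl (Fin.last p)
          have h2 := hd i
          rw [hc] at h1
          simp only [of_apply, Fin.snoc_castSucc, Fin.snoc_last, Fin.succ_last, hc, one_mul, hlast,
            h1]
          rw [add_zero (|_|), h2]
          simp [V, -neg_add_rev]
        · have h1 := hl j.castSucc
          have h2 := hl' j
          have h3 := hl j.succ
          have h4 := habs j.succ
          rw [← Fin.succ_castSucc] at h3 h4
          rw [h2] at h3
          simp only [of_apply, Fin.snoc_castSucc, one_mul]
          rw [Fin.succ_castSucc, Fin.snoc_castSucc, ← Fin.succ_castSucc, h4, h1, h2]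
          simp only [V, ← h3]
          ring
  have step3 := mul_left_cancel₀ hκ0 step2
  rw [step1, sum_det_columns_snoc, step3, ← mul_assoc, ← mul_assoc, mul_assoc (_ * _) _ (∏ j, _)]
  simp only [prod_val_zpow, ← val_zpow_add]
  -- All powers of q collected on the way cancel.
  rw [show A + ∑ j, -c j + (∑ j, (2 * c j + 2) + ∑ j : Fin (p + 1), -(lam j.castSucc + c j + 2)) = 0
    from ?_]
  · simp
  · simp only [A, ← Finset.sum_add_distrib]
    refine Finset.sum_eq_zero fun j _ => ?_
    ring

/-! ### Splitting patterns into rows -/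

theorem sum_Icc_one_eq {M : Type*} [AddCommMonoid M] (f : ℕ → M) (n : ℕ) :
    ∑ j ∈ Finset.Icc 1 n, f j = ∑ j : Fin n, f (j + 1) := by
  induction n with
  | zero => simp
  | succ n ih => rw [Finset.sum_Icc_succ_top (by omega), ih, Fin.sum_univ_castSucc]; rfl

theorem IsOrthogonalPattern.even_sub {N : ℕ} {z : ℕ → ℕ → ℤ} (hz : IsOrthogonalPattern N z)
    {k : ℤ} {i₀ j₀ : ℕ} (h₀ : IsPosition N i₀ j₀) (hk : Even (z i₀ j₀ - k)) {i j : ℕ}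
    (h : IsPosition N i j) : Even (z i j - k) := by
  rcases hz.integral with hp | hp
  · obtain ⟨x, hx⟩ := hp i j h
    obtain ⟨y, hy⟩ := hp i₀ j₀ h₀
    obtain ⟨w, hw⟩ := hk
    exact ⟨x - y + w, by omega⟩
  · obtain ⟨x, hx⟩ := hp i j h
    obtain ⟨y, hy⟩ := hp i₀ j₀ h₀
    obtain ⟨w, hw⟩ := hk
    exact ⟨x - y + w, by omega⟩

theorem integral_of_even_sub {N : ℕ} {z : ℕ → ℕ → ℤ} (k : ℤ)
    (h : ∀ i j, IsPosition N i j → Even (z i j - k)) :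
    (∀ i j, IsPosition N i j → Even (z i j)) ∨ (∀ i j, IsPosition N i j → Odd (z i j)) := by
  rcases Int.even_or_odd k with ⟨y, hy⟩ | ⟨y, hy⟩
  · left
    intro i j hp
    obtain ⟨x, hx⟩ := h i j hp
    exact ⟨x + y, by omega⟩
  · right
    intro i j hp
    obtain ⟨x, hx⟩ := h i j hp
    exact ⟨x + y, by omega⟩

/-- The first `n` entries (numbered from `1`) of row `i` of a pattern. -/
def row (z : ℕ → ℕ → ℤ) (i n : ℕ) : Fin n → ℤ := fun j => z i (j + 1)

/-- The rows of a pattern down to row `N`. -/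
def truncate (N : ℕ) (z : ℕ → ℕ → ℤ) : ℕ → ℕ → ℤ := fun i j => if i ≤ N then z i j else 0

/-- A vector as a sequence indexed from `1`. -/
def entry {n : ℕ} (mu : Fin n → ℤ) (j : ℕ) : ℤ :=
  if h : 1 ≤ j ∧ j ≤ n then mu ⟨j - 1, by omega⟩ else 0

theorem entry_succ {n : ℕ} (mu : Fin n → ℤ) (j : Fin n) : entry mu (j + 1) = mu j := by
  simp [entry]

theorem entry_eq_zero {n : ℕ} (mu : Fin n → ℤ) {j : ℕ} (h : ¬(1 ≤ j ∧ j ≤ n)) :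
    entry mu j = 0 := by
  simp [entry, h]

/-- A pattern of height `2 * n - 1` with two more rows. -/
def extend {n : ℕ} (z : ℕ → ℕ → ℤ) (mu : Fin n → ℤ) (lam : Fin (n + 1) → ℤ) : ℕ → ℕ → ℤ :=
  fun i j => if i ≤ 2 * n - 1 then z i j else if i = 2 * n then entry mu j else
    if i = 2 * n + 1 then entry lam j else 0

theorem IsOrthogonalPattern.truncate {M N : ℕ} {z : ℕ → ℕ → ℤ} (hz : IsOrthogonalPattern N z)
    (hMN : M ≤ N) : IsOrthogonalPattern M (truncate M z) := by
  have hpos : ∀ {i j}, IsPosition M i j → IsPosition N i j := fun h =>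
    ⟨h.1, h.2.1.trans hMN, h.2.2⟩
  have hval : ∀ {i j}, IsPosition M i j → OrthogonalCharacters.truncate M z i j = z i j :=
    fun h => if_pos h.2.1
  refine ⟨fun i j h => ?_, ?_, fun i j h => ?_, fun i j h h' => ?_, fun i j h h' => ?_⟩
  · unfold OrthogonalCharacters.truncate
    split_ifs with hi
    · exact hz.zero_outside i j fun h' => h ⟨h'.1, hi, h'.2.2⟩
    · rfl
  · rcases hz.integral with h | h
    · exact Or.inl fun i j hp => by rw [hval hp]; exact h i j (hpos hp)
    · exact Or.inr fun i j hp => by rw [hval hp]; exact h i j (hpos hp)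
  · rw [hval h]
    exact hz.nonneg i j (hpos h)
  · rw [hval h, hval h']
    exact hz.le_below i j (hpos h) (hpos h')
  · rw [hval h, hval h']
    exact hz.below_le i j (hpos h) (hpos h')

theorem mem_orthogonalPatterns_iff {N n : ℕ} {lam : Fin n → ℤ} {z : ℕ → ℕ → ℤ} :
    z ∈ orthogonalPatterns N lam ↔ IsOrthogonalPattern N z ∧ row z N n = lam :=
  and_congr_right fun _ => ⟨fun h => funext h, fun h j => congrFun h j⟩

theorem weightExponent_congr {z z' : ℕ → ℕ → ℤ} {i : ℕ} (hi : 1 ≤ i)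
    (h : ∀ a ≤ 2 * i - 1, z a = z' a) : weightExponent z i = weightExponent z' i := by
  unfold weightExponent patternType
  rw [h 1 (by omega), h (2 * i - 3) (by omega), h (2 * i - 1) (by omega),
    h (2 * i - 1 - 1) (by omega), h (2 * i - 2) (by omega), h (2 * i - 2 - 1) (by omega)]

/-- Row 2n enters both types, with opposite signs, hence the factor 2. For n = 0 the lower rows are
empty and sgn a * |a| = a recovers the special first exponent. -/
theorem weightExponent_succ (z : ℕ → ℕ → ℤ) (n : ℕ) :
    weightExponent z (n + 1) =
      lastSgn (row z (2 * n + 1) (n + 1)) * lastSgn (row z (2 * n - 1) n) *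
        (∑ i, |row z (2 * n + 1) (n + 1) i| + ∑ i, |row z (2 * n - 1) n i| -
          2 * ∑ i, |row z (2 * n) n i|) := by
  cases n with
  | zero => simp [weightExponent, lastSgn, row, sgn_mul_abs]
  | succ p =>
    unfold weightExponent patternType
    rw [if_neg (by omega)]
    simp only [sum_Icc_one_eq]
    rw [show 2 * (p + 1 + 1) - 3 = 2 * p + 1 by omega, show 2 * (p + 1 + 1) - 1 = 2 * p + 3 by omega,
      show 2 * (p + 1 + 1) - 2 = 2 * p + 2 by omega, show 2 * p + 3 - 1 = 2 * p + 2 by omega,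
      show 2 * p + 2 - 1 = 2 * p + 1 by omega, show (2 * p + 3 + 1) / 2 = p + 2 by omega,
      show (2 * p + 3) / 2 = p + 1 by omega,
      show (2 * p + 2) / 2 = p + 1 by omega, show p + 1 + 1 - 1 = p + 1 by omega,
      show 2 * (p + 1) + 1 = 2 * p + 3 by omega, show 2 * (p + 1) - 1 = 2 * p + 1 by omega,
      show 2 * (p + 1) = 2 * p + 2 by omega]
    simp only [lastSgn, row, Fin.val_last]
    ring

theorem patternWeight_congr {n : ℕ} (r : Fin n → Rˣ) {z z' : ℕ → ℕ → ℤ}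
    (h : ∀ a ≤ 2 * n - 1, z a = z' a) : patternWeight r z = patternWeight r z' := by
  unfold patternWeight
  congr 1
  refine Finset.prod_congr rfl fun i _ => ?_
  congr 1
  have := i.isLt
  exact weightExponent_congr (by omega) fun a ha => h a (by omega)

theorem patternWeight_succ {n : ℕ} (r : Fin (n + 1) → Rˣ) (z : ℕ → ℕ → ℤ) :
    patternWeight r z = ((r (Fin.last n) ^ weightExponent z (n + 1) : Rˣ) : R) *
      patternWeight (fun i => r i.castSucc) (truncate (2 * n - 1) z) := by
  rw [← patternWeight_congr (z := z) (z' := truncate (2 * n - 1) z) (fun i => r i.castSucc)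
    fun a ha => funext fun b => (if_pos ha).symm]
  unfold patternWeight
  rw [Fin.prod_univ_castSucc, mul_comm, Units.val_mul]
  rfl

section Rows

variable {n k : ℕ} {lam : Fin (n + 1) → ℤ} {z : ℕ → ℕ → ℤ}

theorem abs_row_castSucc_le (hz : IsOrthogonalPattern (2 * n + 1) z) (j : Fin n) :
    |row z (2 * n - 1) n j| ≤ row z (2 * n) n j ∧
      row z (2 * n) n j ≤ |row z (2 * n + 1) (n + 1) j.castSucc| ∧
      |row z (2 * n + 1) (n + 1) j.succ| ≤ row z (2 * n) n j := by
  have hj := j.isLt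
  have h0 : 0 ≤ z (2 * n) (j + 1) :=
    hz.nonneg _ _ ⟨by omega, by omega, by omega, by omega⟩ (by omega)
  have h1 := hz.le_below (2 * n - 1) (j + 1) ⟨by omega, by omega, by omega, by omega⟩
    ⟨by omega, by omega, by omega, by omega⟩
  have h2 := hz.le_below (2 * n) (j + 1) ⟨by omega, by omega, by omega, by omega⟩
    ⟨by omega, by omega, by omega, by omega⟩
  have h3 := hz.below_le (2 * n) (j + 1) ⟨by omega, by omega, by omega, by omega⟩
    ⟨by omega, by omega, by omega, by omega⟩
  rw [show 2 * n - 1 + 1 = 2 * n by omega] at h1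
  rw [abs_of_nonneg h0] at h1 h2 h3
  exact ⟨h1, h2, h3⟩

theorem row_le_abs_row {p : ℕ} (hz : IsOrthogonalPattern (2 * (p + 1) + 1) z) (j : Fin p) :
    row z (2 * (p + 1)) (p + 1) j.succ ≤ |row z (2 * (p + 1) - 1) (p + 1) j.castSucc| := by
  have hj := j.isLt
  have h := hz.below_le (2 * (p + 1) - 1) (j + 1) ⟨by omega, by omega, by omega, by omega⟩
    ⟨by omega, by omega, by omega, by omega⟩
  exact (le_abs_self _).trans h

theorem row_even_sub (hz : IsOrthogonalPattern (2 * n + 1) z) (hl : row z (2 * n + 1) (n + 1) = lam)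
    (hlam : lam ∈ signedPartitionsIn (n + 1) k) {i j : ℕ} (h : IsPosition (2 * n + 1) i j) :
    Even (z i j - k) := by
  refine hz.even_sub (i₀ := 2 * n + 1) (j₀ := 1) ⟨by omega, by omega, by omega, by omega⟩ ?_ h
  have := (mem_signedPartitionsIn.1 hlam).2.1 0
  rwa [← hl] at this

theorem row_mem_between (hz : IsOrthogonalPattern (2 * n + 1) z)
    (hl : row z (2 * n + 1) (n + 1) = lam) (hlam : lam ∈ signedPartitionsIn (n + 1) k) :
    row z (2 * n) n ∈ between k lam (row z (2 * n - 1) n) := by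
  rw [mem_between]
  intro j
  have hj := j.isLt
  obtain ⟨h1, h2, h3⟩ := abs_row_castSucc_le hz j
  rw [hl] at h2 h3
  refine ⟨⟨h3, h1, h2, ?_⟩, row_even_sub hz hl hlam ⟨by omega, by omega, by omega, by omega⟩⟩
  cases n with
  | zero => exact j.elim0
  | succ p =>
    revert h2
    refine Fin.cases (fun h2 => ?_) (fun j _ => ?_) j
    · rw [extendAbs_castSucc_zero]
      exact h2
    · rw [extendAbs_castSucc_succ]
      exact row_le_abs_row hz j

theorem row_mem_signedPartitionsIn (hz : IsOrthogonalPattern (2 * n + 1) z)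
    (hl : row z (2 * n + 1) (n + 1) = lam) (hlam : lam ∈ signedPartitionsIn (n + 1) k) :
    row z (2 * n - 1) n ∈ signedPartitionsIn n k := by
  rw [mem_signedPartitionsIn]
  refine ⟨fun j => ?_, fun j => ?_, fun i j hij => ?_⟩
  · obtain ⟨h1, h2, h3⟩ := abs_row_castSucc_le hz j
    rw [hl] at h2
    exact h1.trans (h2.trans ((mem_signedPartitionsIn.1 hlam).1 _))
  · have hj := j.isLt
    exact row_even_sub hz hl hlam ⟨by omega, by omega, by omega, by omega⟩
  · cases n with
    | zero => exact i.elim0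
    | succ p =>
      refine abs_le_of_adjacent (fun j => ?_) hij
      have hj := j.isLt
      have h0 : 0 ≤ row z (2 * (p + 1) - 1) (p + 1) j.castSucc := by
        refine hz.nonneg _ _ ⟨by omega, by omega, by omega, ?_⟩ ?_ <;>
          simp only [Fin.val_castSucc] <;> omega
      have h := row_le_abs_row hz j
      rw [abs_of_nonneg h0] at h
      exact (abs_row_castSucc_le hz j.succ).1.trans h

theorem row_truncate {N i m : ℕ} (h : i ≤ N) : row (truncate N z) i m = row z i m := by
  funext j
  exact if_pos h

theorem row_extend_odd (mu : Fin n → ℤ) : row (extend z mu lam) (2 * n + 1) (n + 1) = lam := by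
  funext j
  simp only [row, extend]
  rw [if_neg (by omega), if_neg (by omega), if_pos trivial, entry_succ]

theorem row_extend_even (mu : Fin n → ℤ) : row (extend z mu lam) (2 * n) n = mu := by
  funext j
  have := j.isLt
  simp only [row, extend]
  rw [if_neg (by omega), if_pos trivial, entry_succ]

theorem truncate_extend (mu : Fin n → ℤ) (hz : IsOrthogonalPattern (2 * n - 1) z) :
    truncate (2 * n - 1) (extend z mu lam) = z := by
  funext i j
  unfold truncate extend
  split_ifs with h
  · rfl
  · exact (hz.zero_outside i j fun h' => h h'.2.1).symm

theorem extend_truncate (hz : IsOrthogonalPattern (2 * n + 1) z) :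
    extend (truncate (2 * n - 1) z) (row z (2 * n) n) (row z (2 * n + 1) (n + 1)) = z := by
  have key : ∀ i m : ℕ, m = (i + 1) / 2 → ∀ j, entry (row z i m) j = z i j := by
    rintro i m rfl j
    by_cases h : 1 ≤ j ∧ j ≤ (i + 1) / 2
    · simp only [entry, row]
      rw [dif_pos h, Nat.sub_add_cancel h.1]
    · rw [entry_eq_zero _ h]
      exact (hz.zero_outside i j fun h' => h h'.2.2).symm
  funext i j
  unfold extend truncate
  split_ifs with h1 h2 h3
  · rfl
  · rw [key _ _ (by omega), h2]
  · rw [key _ _ (by omega), h3]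
  · exact (hz.zero_outside i j fun h' => by have := h'.2.1; omega).symm

theorem isOrthogonalPattern_extend {nu mu : Fin n → ℤ} (hz : IsOrthogonalPattern (2 * n - 1) z)
    (hn : row z (2 * n - 1) n = nu) (hlam : lam ∈ signedPartitionsIn (n + 1) k)
    (hnu : nu ∈ signedPartitionsIn n k) (hmu : mu ∈ between k lam nu) :
    IsOrthogonalPattern (2 * n + 1) (extend z mu lam) := by
  have hlow : ∀ {i j}, i ≤ 2 * n - 1 → extend z mu lam i j = z i j := fun h => if_pos h
  have heven : ∀ j : Fin n, extend z mu lam (2 * n) (j + 1) = mu j :=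
    congrFun (row_extend_even (z := z) (lam := lam) mu)
  have hodd : ∀ j : Fin (n + 1), extend z mu lam (2 * n + 1) (j + 1) = lam j :=
    congrFun (row_extend_odd (z := z) (lam := lam) mu)
  have hn' : ∀ j : Fin n, z (2 * n - 1) (j + 1) = nu j := congrFun hn
  rw [mem_between] at hmu
  have hmu0 : ∀ j, 0 ≤ mu j := fun j => (abs_nonneg _).trans (hmu j).1.1
  have hcases : ∀ {i j}, IsPosition (2 * n + 1) i j → IsPosition (2 * n - 1) i j ∨
      (i = 2 * n ∧ ∃ j' : Fin n, j = j' + 1) ∨ (i = 2 * n + 1 ∧ ∃ j' : Fin (n + 1), j = j' + 1) := by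
    rintro i j ⟨h1, h2, h3, h4⟩
    by_cases h : i ≤ 2 * n - 1
    · exact Or.inl ⟨h1, h, h3, h4⟩
    · right
      by_cases h' : i = 2 * n
      · exact Or.inl ⟨h', ⟨j - 1, by omega⟩, by simp only; omega⟩
      · exact Or.inr ⟨by omega, ⟨j - 1, by omega⟩, by simp only; omega⟩
  refine ⟨fun i j h => ?_, integral_of_even_sub k fun i j h => ?_, fun i j h hij => ?_,
    fun i j h h' => ?_, fun i j h h' => ?_⟩
  · unfold extend
    split_ifs with h1 h2 h3
    · exact hz.zero_outside i j fun h' => h ⟨h'.1, by have := h'.2.1; omega, h'.2.2⟩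
    · exact entry_eq_zero _ fun h' => h ⟨by omega, by omega, h'.1, by omega⟩
    · exact entry_eq_zero _ fun h' => h ⟨by omega, by omega, h'.1, by omega⟩
    · rfl
  · rcases hcases h with h | ⟨rfl, j', rfl⟩ | ⟨rfl, j', rfl⟩
    · rw [hlow h.2.1]
      obtain ⟨h1, h2, h3, h4⟩ := h
      refine hz.even_sub (i₀ := 2 * n - 1) (j₀ := 1) ⟨by omega, by omega, by omega, by omega⟩ ?_
        ⟨h1, h2, h3, h4⟩
      have hpos : 0 < n := by omega
      have := hn' ⟨0, hpos⟩
      simp only [zero_add] at this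
      rw [this]
      exact (mem_signedPartitionsIn.1 hnu).2.1 _
    · rw [heven]
      exact (hmu j').2
    · rw [hodd]
      exact (mem_signedPartitionsIn.1 hlam).2.1 _
  · rcases hcases h with h | ⟨rfl, j', rfl⟩ | ⟨rfl, j', rfl⟩
    · rw [hlow h.2.1]
      exact hz.nonneg i j h hij
    · rw [heven]
      exact hmu0 j'
    · rw [hodd]
      obtain ⟨j', rfl⟩ | rfl := j'.eq_castSucc_or_eq_last
      · rw [← abs_of_mem_signedPartitionsIn hlam]
        exact abs_nonneg _
      · simp at hij
        omega
  · rcases hcases h' with h' | ⟨hi, j', rfl⟩ | ⟨hi, j', rfl⟩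
    · rw [hlow h'.2.1, hlow (by have := h'.2.1; omega)]
      exact hz.le_below i j ⟨h.1, by have := h'.2.1; omega, h.2.2⟩ h'
    · rw [hi, heven, hlow (by omega), show i = 2 * n - 1 by omega, hn', abs_of_nonneg (hmu0 _)]
      exact (hmu j').1.2.1
    · obtain rfl : i = 2 * n := by omega
      have hj : (j' : ℕ) < n := by have := h.2.2.2; omega
      rw [hodd]
      have h1 := heven ⟨j', hj⟩
      simp only at h1
      rw [h1, abs_of_nonneg (hmu0 _)]
      exact (hmu ⟨j', hj⟩).1.2.2.1
  · rcases hcases h' with h' | ⟨hi, j', hj'⟩ | ⟨hi, j', hj'⟩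
    · rw [hlow h'.2.1, hlow (by have := h'.2.1; omega)]
      exact hz.below_le i j ⟨h.1, by have := h'.2.1; omega, h.2.2⟩ h'
    · obtain rfl : j = j' := by omega
      have hj := h.2.2.1
      cases n with
      | zero => exact j'.elim0
      | succ p =>
        obtain ⟨j', rfl⟩ : ∃ a : Fin p, j' = a.succ := ⟨⟨j' - 1, by omega⟩, by
          ext
          simp only [Fin.succ_mk]
          omega⟩
        have h1 := (hmu j'.succ).1.2.2.2
        rw [extendAbs_castSucc_succ] at h1
        have h2 := hn' j'.castSucc
        rw [hi, heven, hlow (by omega), show i = 2 * (p + 1) - 1 by omega, Fin.val_succ]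
        rw [Fin.val_castSucc] at h2
        rw [h2, abs_of_nonneg (hmu0 _)]
        exact h1
    · obtain rfl : j = j' := by omega
      obtain rfl : i = 2 * n := by omega
      have hj := h.2.2.1
      have hjn := j'.isLt
      obtain ⟨j', rfl⟩ : ∃ a : Fin n, j' = a.succ := ⟨⟨j' - 1, by omega⟩, by
          ext
          simp only [Fin.succ_mk]
          omega⟩
      rw [hodd, Fin.val_succ, heven, abs_of_nonneg (hmu0 _)]
      exact (hmu j').1.1

end Rows

/-! ### Branching of characters, and odd rectangular characters -/

/-- The branching rule from `SO(2n + 2)` to `SO(2n)`. -/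
theorem soEven_succ {n k : ℕ} {lam : Fin (n + 1) → ℤ} (hlam : lam ∈ signedPartitionsIn (n + 1) k)
    (r : Fin (n + 1) → Rˣ) :
    soEven lam r = ∑ nu ∈ signedPartitionsIn n k,
      branch k lam nu (r (Fin.last n)) * soEven nu fun i => r i.castSucc := by
  unfold soEven branch
  simp only [Finset.sum_mul_sum]
  simp only [← Finset.sum_product']
  rw [Finset.sum_sigma']
  refine Finset.sum_bij'
    (fun z _ => ⟨row z (2 * n - 1) n, row z (2 * n) n, truncate (2 * n - 1) z⟩)
    (fun x _ => extend x.2.2 x.2.1 lam) ?_ ?_ ?_ ?_ ?_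
  · intro z hz
    rw [Set.Finite.mem_toFinset, mem_orthogonalPatterns_iff] at hz
    obtain ⟨hz, hl⟩ := hz
    -- The height 2 * (n + 1) - 1 reduces to 2 * n + 1.
    change IsOrthogonalPattern (2 * n + 1) z at hz
    rw [Finset.mem_sigma, Finset.mem_product, Set.Finite.mem_toFinset, mem_orthogonalPatterns_iff]
    exact ⟨row_mem_signedPartitionsIn hz hl hlam, row_mem_between hz hl hlam,
      hz.truncate (by omega), row_truncate le_rfl⟩
  · rintro ⟨nu, mu, z⟩ hx
    rw [Finset.mem_sigma, Finset.mem_product, Set.Finite.mem_toFinset, mem_orthogonalPatterns_iff] at hx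
    obtain ⟨hnu, hmu, hz, hn⟩ := hx
    rw [Set.Finite.mem_toFinset, mem_orthogonalPatterns_iff]
    exact ⟨isOrthogonalPattern_extend hz hn hlam hnu hmu, row_extend_odd mu⟩
  · intro z hz
    rw [Set.Finite.mem_toFinset, mem_orthogonalPatterns_iff] at hz
    obtain ⟨hz, rfl⟩ := hz
    exact extend_truncate hz
  · rintro ⟨nu, mu, z⟩ hx
    rw [Finset.mem_sigma, Finset.mem_product, Set.Finite.mem_toFinset, mem_orthogonalPatterns_iff] at hx
    obtain ⟨-, -, hz, hn⟩ := hx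
    have h1 := truncate_extend (lam := lam) mu hz
    have h2 : row (extend z mu lam) (2 * n - 1) n = nu := by
      rw [← row_truncate le_rfl, h1]
      exact hn
    simp only [h1, h2, row_extend_even]
  · intro z hz
    rw [Set.Finite.mem_toFinset, mem_orthogonalPatterns_iff] at hz
    obtain ⟨hz, hl⟩ := hz
    change IsOrthogonalPattern (2 * n + 1) z at hz
    change row z (2 * n + 1) (n + 1) = lam at hl
    rw [patternWeight_succ, weightExponent_succ, hl]
    have : ∀ i, |row z (2 * n) n i| = row z (2 * n) n i := fun i =>
      abs_of_nonneg ((abs_nonneg _).trans (abs_row_castSucc_le hz i).1)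
    simp only [this]

theorem soEven_zero (lam : Fin 0 → ℤ) (r : Fin 0 → Rˣ) : soEven lam r = 1 := by
  have : (orthogonalPatterns_finite (2 * 0 - 1) (by omega) lam).toFinset = {fun _ _ => 0} := by
    ext z
    rw [Set.Finite.mem_toFinset, mem_orthogonalPatterns_iff, Finset.mem_singleton]
    have hp : ∀ i j, ¬IsPosition (2 * 0 - 1) i j := fun i j h => by
      have := h.1
      have := h.2.1
      omega
    constructor
    · rintro ⟨hz, -⟩
      funext i j
      exact hz.zero_outside i j (hp i j)
    · rintro rfl
      exact ⟨⟨fun _ _ _ => rfl, Or.inl fun i j h => (hp i j h).elim, fun i j h => (hp i j h).elim,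
        fun i j h => (hp i j h).elim, fun i j h => (hp i j h).elim⟩, Subsingleton.elim _ _⟩
  unfold soEven
  rw [this]
  simp [patternWeight]

theorem isOrthogonalPattern_addRow {n k : ℕ} {z : ℕ → ℕ → ℤ} (hz : IsOrthogonalPattern (2 * n) z)
    (hl : row z (2 * n) n = rect k n) :
    IsOrthogonalPattern (2 * n + 1)
      fun i j => if i = 2 * n + 1 then entry (rect k (n + 1)) j else z i j := by
  have hk : |(k : ℤ)| = k := abs_of_nonneg (by omega)
  have hrow : ∀ j, 1 ≤ j → j ≤ n → z (2 * n) j = k := by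
    intro j h1 h2
    have := congrFun hl ⟨j - 1, by omega⟩
    simpa [row, rect, Nat.sub_add_cancel h1] using this
  have hentry : ∀ j, 1 ≤ j → j ≤ n + 1 → entry (rect k (n + 1)) j = k := by
    intro j h1 h2
    simp only [entry, rect]
    rw [dif_pos ⟨h1, h2⟩]
  have hpos : ∀ {i j}, i ≠ 2 * n + 1 → IsPosition (2 * n + 1) i j → IsPosition (2 * n) i j :=
    fun hi h => ⟨h.1, by have := h.2.1; omega, h.2.2⟩
  refine ⟨fun i j h => ?_, integral_of_even_sub k fun i j h => ?_, fun i j h hij => ?_,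
    fun i j h h' => ?_, fun i j h h' => ?_⟩
  · split_ifs with hi
    · exact entry_eq_zero _ fun h' => h ⟨by omega, by omega, h'.1, by omega⟩
    · exact hz.zero_outside i j fun h' => h ⟨h'.1, by have := h'.2.1; omega, h'.2.2⟩
  · split_ifs with hi
    · obtain ⟨h1, h2, h3, h4⟩ := h
      rw [hentry j h3 (by omega)]
      simp
    · have h' := hpos hi h
      obtain ⟨h1, h2, h3, h4⟩ := h'
      refine hz.even_sub (i₀ := 2 * n) (j₀ := 1) ⟨by omega, by omega, by omega, by omega⟩ ?_
        (hpos hi h)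
      rw [hrow 1 (by omega) (by omega)]
      simp
  · split_ifs with hi
    · obtain ⟨h1, h2, h3, h4⟩ := h
      rw [hentry j h3 (by omega)]
      omega
    · exact hz.nonneg i j (hpos hi h) hij
  · have hi : i ≠ 2 * n + 1 := by have := h'.2.1; omega
    rw [if_neg hi]
    split_ifs with hi'
    · obtain rfl : i = 2 * n := by omega
      obtain ⟨h1, h2, h3, h4⟩ := h
      rw [hentry j h3 (by omega), hrow j h3 (by omega)]
    · exact hz.le_below i j (hpos hi h) (hpos hi' h')
  · have hi : i ≠ 2 * n + 1 := by have := h'.2.1; omega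
    rw [if_neg hi]
    split_ifs with hi'
    · obtain rfl : i = 2 * n := by omega
      obtain ⟨h1, h2, h3, h4⟩ := h
      rw [hentry (j + 1) (by omega) (by omega), hrow j h3 (by omega)]
    · exact hz.below_le i j (hpos hi h) (hpos hi' h')

/-- A constant bottom row forces the row above it to be constant, so it can be removed or added
freely; the variable 1 makes its weight trivial. -/
theorem soOdd_rect (k n : ℕ) (r : Fin n → Rˣ) :
    soOdd (rect k n) r = soEven (rect k (n + 1)) (Fin.snoc r 1 : Fin (n + 1) → Rˣ) := by
  have hk : |(k : ℤ)| = k := abs_of_nonneg (by omega)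
  unfold soOdd soEven
  symm
  refine Finset.sum_bij' (fun z _ => truncate (2 * n) z)
    (fun z _ => fun i j => if i = 2 * n + 1 then entry (rect k (n + 1)) j else z i j)
    ?_ ?_ ?_ ?_ ?_
  · intro z hz
    rw [Set.Finite.mem_toFinset, mem_orthogonalPatterns_iff] at hz ⊢
    obtain ⟨hz, hl⟩ := hz
    change IsOrthogonalPattern (2 * n + 1) z at hz
    change row z (2 * n + 1) (n + 1) = _ at hl
    refine ⟨hz.truncate (by omega), ?_⟩
    rw [row_truncate le_rfl]
    funext j
    obtain ⟨-, h2, h3⟩ := abs_row_castSucc_le hz j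
    rw [hl] at h2 h3
    simp only [rect, hk] at h2 h3 ⊢
    exact le_antisymm h2 h3
  · intro z hz
    rw [Set.Finite.mem_toFinset, mem_orthogonalPatterns_iff] at hz ⊢
    refine ⟨isOrthogonalPattern_addRow hz.1 hz.2, ?_⟩
    funext j
    simp only [row]
    rw [if_pos (by omega), entry_succ]
  · intro z hz
    rw [Set.Finite.mem_toFinset, mem_orthogonalPatterns_iff] at hz
    obtain ⟨hz, hl⟩ := hz
    change IsOrthogonalPattern (2 * n + 1) z at hz
    change row z (2 * n + 1) (n + 1) = _ at hl
    funext i j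
    simp only [truncate]
    split_ifs with h1 h2
    · rw [h1, ← hl]
      by_cases h : 1 ≤ j ∧ j ≤ n + 1
      · simp only [entry, row]
        rw [dif_pos h, Nat.sub_add_cancel h.1]
      · rw [entry_eq_zero _ h]
        exact (hz.zero_outside _ j fun h' => h ⟨h'.2.2.1, by have := h'.2.2.2; omega⟩).symm
    · rfl
    · exact (hz.zero_outside i j fun h' => by have := h'.2.1; omega).symm
  · intro z hz
    rw [Set.Finite.mem_toFinset, mem_orthogonalPatterns_iff] at hz
    funext i j
    simp only [truncate]
    split_ifs with h1 h2
    · omega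
    · rfl
    · exact (hz.1.zero_outside i j fun h' => h1 h'.2.1).symm
  · intro z _
    rw [patternWeight_succ, Fin.snoc_last, one_zpow, Units.val_one, one_mul]
    simp only [Fin.snoc_castSucc]
    refine patternWeight_congr r fun a ha => funext fun b => ?_
    simp only [truncate]
    rw [if_pos ha, if_pos (by omega)]

/-! ### The Weyl character formula and symmetry -/

/-- The denominator of the Weyl character formula. -/
noncomputable def weylDenominator {n : ℕ} (r : Fin n → Rˣ) : R :=
  (Matrix.vandermonde fun i => -trace (r i)).det

/-- The minus sign in the Vandermonde nodes gives the factors the orientation they have in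
`sum_branch_mul_alternant`. -/
theorem weylDenominator_succ {n : ℕ} (r : Fin (n + 1) → Rˣ) :
    weylDenominator r = weylDenominator (fun i => r i.castSucc) *
      ∏ i : Fin n, (trace (r i.castSucc) - trace (r (Fin.last n))) := by
  have h : ∀ {m : ℕ} (v : Fin m → R), (Matrix.vandermonde v).det =
      ∏ i, ∏ j, if i < j then v j - v i else 1 := by
    intro m v
    rw [Matrix.det_vandermonde]
    refine Finset.prod_congr rfl fun i _ => ?_
    rw [← Finset.prod_filter]
    congr 1
    ext j
    simp
  unfold weylDenominator
  rw [h, h, Fin.prod_univ_castSucc]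
  simp only [Fin.prod_univ_castSucc, Fin.castSucc_lt_castSucc_iff, Fin.castSucc_lt_last, if_true,
    lt_irrefl, if_false, mul_one, Finset.prod_mul_distrib]
  rw [Finset.prod_eq_one (s := Finset.univ) (f := fun j : Fin n =>
    if Fin.last n < j.castSucc then _ else _), mul_one]
  · congr 1
    refine Finset.prod_congr rfl fun i _ => ?_
    ring
  · intro j _
    rw [if_neg (not_lt.2 (Fin.le_last _))]

/-- The Weyl character formula. -/
theorem soEven_mul_weylDenominator [IsDomain R] {n k : ℕ} {lam : Fin n → ℤ}
    (hlam : lam ∈ signedPartitionsIn n k) (r : Fin n → Rˣ)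
    (hr : ∀ i, ((r i ^ (-2 : ℤ) : Rˣ) : R) - ((r i ^ (2 : ℤ) : Rˣ) : R) ≠ 0) :
    soEven lam r * (2 * weylDenominator r) = alternant 1 lam r + alternant (-1) lam r := by
  induction n with
  | zero =>
    simp only [soEven_zero, weylDenominator, alternant, Matrix.det_isEmpty]
    norm_num
  | succ n ih =>
    -- One variable is treated by hand, since the alternant rule needs a nonempty lower row.
    cases n with
    | zero =>
      rw [soEven_succ hlam, weylDenominator_succ]
      have h0 : ∀ f : Fin 0 → ℤ, f ∈ signedPartitionsIn 0 k := fun f =>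
        mem_signedPartitionsIn.2 ⟨fun i => i.elim0, fun i => i.elim0, fun i => i.elim0⟩
      have h1 : signedPartitionsIn 0 k = {Fin.elim0} := by
        ext f
        simp only [h0, Finset.mem_singleton, true_iff]
        exact Subsingleton.elim _ _
      rw [h1, Finset.sum_singleton]
      have h2 : ∀ q : Rˣ, (branch k lam Fin.elim0 q : R) = ((q ^ lam 0 : Rˣ) : R) := by
        intro q
        simp [branch, between, lastSgn, sgn_mul_abs]
      have h3 : ∀ s : R, alternant s lam r = twoTerm s (r 0) (lam 0) := by
        intro s
        simp [alternant]
      rw [h2, h3, h3, soEven_zero]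
      simp only [weylDenominator, Matrix.det_isEmpty, Finset.univ_eq_empty, Finset.prod_empty,
        twoTerm]
      rw [show r (Fin.last 0) = r 0 from rfl]
      ring
    | succ p =>
      rw [soEven_succ hlam, weylDenominator_succ, ← sum_branch_mul_alternant (one_mul 1) hlam r (hr _),
        ← sum_branch_mul_alternant (by ring : (-1 : R) * -1 = 1) hlam r (hr _), ← add_mul,
        ← Finset.sum_add_distrib, ← mul_assoc, ← mul_assoc, Finset.sum_mul, Finset.sum_mul]
      congr 1
      refine Finset.sum_congr rfl fun nu hnu => ?_
      rw [← mul_add, ← ih hnu (fun i => r i.castSucc) fun i => hr _]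
      ring

theorem alternant_comp_perm (s : R) {n : ℕ} (lam : Fin n → ℤ) (r : Fin n → Rˣ)
    (σ : Equiv.Perm (Fin n)) :
    alternant s lam (r ∘ σ) = (Equiv.Perm.sign σ : ℤ) * alternant s lam r :=
  Matrix.det_permute σ
    (Matrix.of fun i j : Fin n => twoTerm s (r i) (lam j + 2 * ((n : ℤ) - 1 - (j : ℕ))))

theorem weylDenominator_comp_perm {n : ℕ} (r : Fin n → Rˣ) (σ : Equiv.Perm (Fin n)) :
    weylDenominator (r ∘ σ) = (Equiv.Perm.sign σ : ℤ) * weylDenominator r :=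
  Matrix.det_permute σ (Matrix.vandermonde fun i => -trace (r i))

/-- Numerator and denominator of the Weyl formula change by the same sign; the remaining hypotheses
make the denominator cancellable. -/
theorem soEven_comp_perm_of_isDomain [IsDomain R] {n k : ℕ} {lam : Fin n → ℤ}
    (hlam : lam ∈ signedPartitionsIn n k) (r : Fin n → Rˣ)
    (hr : ∀ i, ((r i ^ (-2 : ℤ) : Rˣ) : R) - ((r i ^ (2 : ℤ) : Rˣ) : R) ≠ 0)
    (htwo : (2 : R) ≠ 0) (hinj : Function.Injective fun i => trace (r i))
    (σ : Equiv.Perm (Fin n)) : soEven lam (r ∘ σ) = soEven lam r := by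
  have hd : weylDenominator (r ∘ σ) ≠ 0 := by
    refine Matrix.det_vandermonde_ne_zero_iff.2 ?_
    intro i j hij
    exact σ.injective (hinj (neg_injective hij))
  refine mul_right_cancel₀ (mul_ne_zero htwo hd) ?_
  rw [soEven_mul_weylDenominator hlam (r ∘ σ) fun i => hr (σ i), alternant_comp_perm,
    alternant_comp_perm, ← mul_add, ← soEven_mul_weylDenominator hlam r hr,
    weylDenominator_comp_perm]
  ring

theorem map_soEven {S : Type*} [CommRing S] (f : S →+* R) {n : ℕ} (lam : Fin n → ℤ)
    (r : Fin n → Sˣ) : f (soEven lam r) = soEven lam fun i => Units.map (f : S →* R) (r i) := by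
  unfold soEven patternWeight
  rw [map_sum]
  refine Finset.sum_congr rfl fun z _ => ?_
  simp only [← map_zpow, ← map_prod]
  rfl

/-- The variables of the ring of Laurent polynomials. -/
noncomputable def laurentX (n : ℕ) (i : Fin n) : (AddMonoidAlgebra ℤ (Fin n → ℤ))ˣ :=
  Units.map (AddMonoidAlgebra.of ℤ (Fin n → ℤ))
    (toUnits (Multiplicative.ofAdd (Pi.single i (1 : ℤ) : Fin n → ℤ)))

theorem laurentX_zpow {n : ℕ} (i : Fin n) (a : ℤ) :
    ((laurentX n i ^ a : (AddMonoidAlgebra ℤ (Fin n → ℤ))ˣ) : AddMonoidAlgebra ℤ (Fin n → ℤ)) =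
      AddMonoidAlgebra.single (Pi.single i a) 1 := by
  unfold laurentX
  rw [← map_zpow, ← map_zpow, Units.coe_map, ← ofAdd_zsmul]
  simp [← Pi.single_smul]

theorem exists_map_laurentX {n : ℕ} (r : Fin n → Rˣ) :
    ∃ f : AddMonoidAlgebra ℤ (Fin n → ℤ) →+* R,
      ∀ i, Units.map (f : AddMonoidAlgebra ℤ (Fin n → ℤ) →* R) (laurentX n i) = r i := by
  let g : Multiplicative (Fin n → ℤ) →* R :=
    { toFun := fun a => ((∏ i, r i ^ (a.toAdd i) : Rˣ) : R)
      map_one' := by simp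
      map_mul' := fun a b => by simp [zpow_add, Finset.prod_mul_distrib] }
  refine ⟨(AddMonoidAlgebra.lift ℤ R (Fin n → ℤ) g : _ →+* R), fun i => Units.ext ?_⟩
  have h := laurentX_zpow i 1
  rw [zpow_one] at h
  rw [Units.coe_map, h]
  change AddMonoidAlgebra.lift ℤ R (Fin n → ℤ) g (AddMonoidAlgebra.single (Pi.single i 1) 1) = _
  rw [AddMonoidAlgebra.lift_single, one_smul]
  change ((∏ j, r j ^ (Pi.single i (1 : ℤ) : Fin n → ℤ) j : Rˣ) : R) = _
  rw [Finset.prod_eq_single i (fun j _ hj => by rw [Pi.single_eq_of_ne hj, zpow_zero])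
    (fun h => (h (Finset.mem_univ i)).elim), Pi.single_eq_same, zpow_one]

/-- Even orthogonal characters are symmetric. -/
theorem soEven_comp_perm {n k : ℕ} {lam : Fin n → ℤ} (hlam : lam ∈ signedPartitionsIn n k)
    (r : Fin n → Rˣ) (σ : Equiv.Perm (Fin n)) : soEven lam (r ∘ σ) = soEven lam r := by
  obtain ⟨f, hf⟩ := exists_map_laurentX r
  have hX : soEven lam (laurentX n ∘ σ) = soEven lam (laurentX n) := by
    have hne : ∀ i j : Fin n, i ≠ j → ∀ a : ℤ, (Pi.single j a : Fin n → ℤ) ≠ Pi.single i 2 :=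
      fun i j hij a h => by simpa [hij] using congrFun h i
    -- The nondegeneracy conditions are checked on one coefficient each: that of the square of the
    -- i-th generator, or the constant one.
    refine soEven_comp_perm_of_isDomain hlam _ (fun i h => ?_) (fun h => ?_) (fun i j h => ?_) σ
    · rw [laurentX_zpow, laurentX_zpow] at h
      have := congrArg (fun x => x.coeff (Pi.single i 2)) h
      simp at this
    · have := congrArg (fun x => x.coeff 0) h
      simp at this
    · simp only [trace, laurentX_zpow] at h
      by_contra hij
      have := congrArg (fun x => x.coeff (Pi.single i 2)) h
      simp [hne i j hij] at this
  have h := congrArg f hX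
  rw [map_soEven, map_soEven] at h
  simp only [Function.comp_apply, hf] at h
  exact h

theorem soEven_withSign_neg {n k : ℕ} {lam : Fin (n + 1) → ℤ}
    (hlam : lam ∈ signedPartitionsIn (n + 1) k) {r r' : Fin (n + 1) → Rˣ}
    (h : ∀ i : Fin n, r' i.castSucc = r i.castSucc) (hlast : r' (Fin.last n) = (r (Fin.last n))⁻¹) :
    soEven (withSign (-1) lam) r = soEven lam r' := by
  rw [soEven_succ (withSign_mem _ hlam), soEven_succ hlam]
  refine Finset.sum_congr rfl fun nu hnu => ?_
  rw [branch_withSign_neg (mem_signedPartitionsIn.1 hlam).2.1 (mem_signedPartitionsIn.1 hnu).2.1,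
    hlast]
  simp only [h]

/-! ### Nearly rectangular shapes and the duality of branching -/

theorem cons_mem_signedPartitionsIn {n k : ℕ} {lam : Fin n → ℤ} :
    (Fin.cons (k : ℤ) lam : Fin (n + 1) → ℤ) ∈ signedPartitionsIn (n + 1) k ↔
      lam ∈ signedPartitionsIn n k := by
  have hk : |(k : ℤ)| = k := abs_of_nonneg (by omega)
  rw [mem_signedPartitionsIn, mem_signedPartitionsIn]
  constructor
  · rintro ⟨h1, h2, h3⟩
    refine ⟨fun i => by simpa using h1 i.succ, fun i => by simpa using h2 i.succ,
      fun i j hij => by simpa using h3 i.succ j.succ (Fin.succ_lt_succ_iff.2 hij)⟩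
  · rintro ⟨h1, h2, h3⟩
    refine ⟨fun i => ?_, fun i => ?_, fun i j => ?_⟩
    · refine Fin.cases ?_ (fun i => ?_) i
      · simp
      · simpa using h1 i
    · refine Fin.cases ?_ (fun i => ?_) i
      · simp
      · simpa using h2 i
    · refine Fin.cases (fun hij => ?_) (fun j => ?_) j
      · simp at hij
      · refine Fin.cases (fun _ => ?_) (fun i hij => ?_) i
        · simpa using h1 j
        · simpa using h3 i j (Fin.succ_lt_succ_iff.1 hij)

theorem rectAppend_self (k : ℕ) {m : ℕ} (lam : Fin m → ℤ) : rectAppend k m lam = lam := by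
  funext i
  simp [rectAppend]

theorem rectAppend_succ (k : ℕ) {m n : ℕ} (h : m ≤ n) (lam : Fin m → ℤ) :
    rectAppend k (n + 1) lam = Fin.cons (k : ℤ) (rectAppend k n lam) := by
  funext i
  refine Fin.cases ?_ (fun i => ?_) i
  · rw [Fin.cons_zero, rectAppend, dif_neg]
    simp only [Fin.val_zero]
    omega
  · rw [Fin.cons_succ]
    unfold rectAppend
    by_cases hi : n - m ≤ (i : ℕ)
    · rw [dif_pos hi, dif_pos (by rw [Fin.val_succ]; omega)]
      congr 1
      ext
      simp only [Fin.val_succ]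
      omega
    · rw [dif_neg hi, dif_neg (by rw [Fin.val_succ]; omega)]

theorem rectAppend_mem {k m n : ℕ} (h : m ≤ n) {lam : Fin m → ℤ}
    (hlam : lam ∈ signedPartitionsIn m k) : rectAppend k n lam ∈ signedPartitionsIn n k := by
  induction n, h using Nat.le_induction with
  | base => rwa [rectAppend_self]
  | succ n h ih => rwa [rectAppend_succ k h, cons_mem_signedPartitionsIn]

theorem lastSgn_cons (k : ℕ) {n : ℕ} (nu : Fin n → ℤ) :
    lastSgn (Fin.cons (k : ℤ) nu : Fin (n + 1) → ℤ) = lastSgn nu := by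
  cases n with
  | zero => simp [lastSgn, sgn]
  | succ n => simp only [lastSgn, ← Fin.succ_last, Fin.cons_succ]

/-- Two boxes that differ by one forced coordinate. -/
theorem sum_between_cons {k : ℤ} {n : ℕ} {L : Fin (n + 2) → ℤ} {N : Fin (n + 1) → ℤ}
    {lam : Fin (n + 1) → ℤ} {nu : Fin n → ℤ} (hl0 : lower L N 0 = k) (hu0 : upper L N 0 = k)
    (hl : ∀ j, lower L N j.succ = lower lam nu j) (hu : ∀ j, upper L N j.succ = upper lam nu j)
    (f : (Fin (n + 1) → ℤ) → R) :
    ∑ mu ∈ between k L N, f mu =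
      ∑ mu ∈ between k lam nu, f (Fin.cons k mu) := by
  have hmem : ∀ mu, mu ∈ between k L N ↔ mu 0 = k ∧ Fin.tail mu ∈ between k lam nu := by
    intro mu
    simp only [between, Fintype.mem_piFinset, mem_parityIcc, Fin.forall_fin_succ, hl0, hu0, hl, hu,
      Fin.tail]
    refine and_congr_left fun _ => ⟨fun h => le_antisymm h.1.2 h.1.1, fun h => ?_⟩
    simp [h]
  refine Finset.sum_bij' (fun mu _ => Fin.tail mu)
    (fun mu _ => (Fin.cons k mu : Fin (n + 1) → ℤ)) ?_ ?_ ?_ ?_ ?_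
  · exact fun mu h => ((hmem mu).1 h).2
  · exact fun mu h => (hmem _).2 ⟨by simp, by simpa using h⟩
  · intro mu h
    rw [← ((hmem mu).1 h).1, Fin.cons_self_tail]
  · intro mu _
    simp
  · intro mu h
    rw [← ((hmem mu).1 h).1, Fin.cons_self_tail]

/-- The first entry of the middle row is squeezed to k, and its contribution -2k cancels the two new
leading entries. -/
theorem branch_cons_cons {k n : ℕ} {lam : Fin (n + 1) → ℤ} (hlam : |lam 0| ≤ k) (nu : Fin n → ℤ)
    (q : Rˣ) :
    (branch k (Fin.cons (k : ℤ) lam : Fin (n + 2) → ℤ) (Fin.cons (k : ℤ) nu : Fin (n + 1) → ℤ) q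
      : R) = branch k lam nu q := by
  have hk : |(k : ℤ)| = k := abs_of_nonneg (by omega)
  unfold branch
  rw [sum_between_cons (lam := lam) (nu := nu)]
  · refine Finset.sum_congr rfl fun mu _ => ?_
    rw [lastSgn_cons, lastSgn_cons]
    simp only [Fin.sum_univ_succ (n := n), Fin.sum_univ_succ (n := n + 1), Fin.cons_zero,
      Fin.cons_succ, hk]
    congr 3
    ring
  · simpa [lower, hk] using hlam
  · simp [upper, extendAbs, hk]
  · intro j
    simp [lower]
  · intro j
    rw [upper, extendAbs_castSucc_succ, upper, ← Fin.succ_castSucc, Fin.cons_succ]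
    cases n with
    | zero => exact j.elim0
    | succ p =>
      refine Fin.cases ?_ (fun j => ?_) j
      · rw [extendAbs_castSucc_zero]
        simpa [hk] using hlam
      · rw [extendAbs_castSucc_succ, ← Fin.succ_castSucc, Fin.cons_succ]

/-- The duality behind the theorem. Once the first entry of the middle row is forced to be k, the
other entries are bounded below by the maxima of |al j| and |be (j + 1)| and above by minima of the
same kind, so the roles of al and be can be exchanged. -/
theorem branch_cons_cons_eq {k t : ℕ} (al : Fin t → ℤ) {be : Fin (t + 1) → ℤ} (hbe : |be 0| ≤ k)
    (q : Rˣ) :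
    (branch k (Fin.cons (k : ℤ) (Fin.cons (k : ℤ) al : Fin (t + 1) → ℤ) : Fin (t + 2) → ℤ) be q
      : R) = branch k be al q := by
  have hk : |(k : ℤ)| = k := abs_of_nonneg (by omega)
  unfold branch
  rw [sum_between_cons (lam := be) (nu := al)]
  · refine Finset.sum_congr rfl fun mu _ => ?_
    rw [lastSgn_cons, lastSgn_cons, mul_comm (lastSgn al)]
    simp only [Fin.sum_univ_succ (n := t), Fin.sum_univ_succ (n := t + 1), Fin.cons_zero,
      Fin.cons_succ, hk]
    congr 3
    ring
  · simpa [lower, hk] using hbe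
  · simp [upper, extendAbs, hk]
  · intro j
    simp [lower, max_comm]
  · intro j
    rw [upper, extendAbs_castSucc_succ, upper, ← Fin.succ_castSucc, Fin.cons_succ, min_comm]
    cases t with
    | zero => exact j.elim0
    | succ p =>
      refine Fin.cases ?_ (fun j => ?_) j
      · rw [extendAbs_castSucc_zero]
        simpa [hk] using hbe
      · rw [extendAbs_castSucc_succ, ← Fin.succ_castSucc, Fin.cons_succ]

theorem sum_signedPartitionsIn_cons {k n : ℕ} (F : (Fin (n + 1) → ℤ) → R)
    (hF : ∀ nu ∈ signedPartitionsIn (n + 1) k, nu 0 ≠ k → F nu = 0) :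
    ∑ nu ∈ signedPartitionsIn (n + 1) k, F nu =
      ∑ nu ∈ signedPartitionsIn n k, F (Fin.cons (k : ℤ) nu) := by
  symm
  refine Finset.sum_of_injOn (fun nu => (Fin.cons (k : ℤ) nu : Fin (n + 1) → ℤ)) ?_ ?_ ?_ ?_
  · exact fun nu _ nu' _ h => Fin.cons_right_injective (α := fun _ => ℤ) _ h
  · exact fun nu h => cons_mem_signedPartitionsIn.2 h
  · intro nu hnu h
    refine hF nu hnu fun h0 => h ⟨Fin.tail nu, ?_, ?_⟩
    · rw [Finset.mem_coe, ← cons_mem_signedPartitionsIn, ← h0, Fin.cons_self_tail]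
      exact hnu
    · simp only
      rw [← h0, Fin.cons_self_tail]
  · exact fun _ _ => rfl

/-- Branching from nearly rectangular shapes. -/
theorem sum_branch_rectAppend {k t : ℕ} {al : Fin t → ℤ} (hal : al ∈ signedPartitionsIn t k)
    (q : Rˣ) {N : ℕ} (hN : t + 1 ≤ N) (g : (Fin N → ℤ) → R) :
    ∑ nu ∈ signedPartitionsIn N k, branch k (rectAppend k (N + 1) al) nu q * g nu =
      ∑ be ∈ signedPartitionsIn (t + 1) k, branch k be al q * g (rectAppend k N be) := by
  have hk : |(k : ℤ)| = k := abs_of_nonneg (by omega)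
  induction N, hN using Nat.le_induction with
  | base =>
    refine Finset.sum_congr rfl fun be hbe => ?_
    rw [rectAppend_succ k (by omega), rectAppend_succ k le_rfl, rectAppend_self,
      branch_cons_cons_eq al ((mem_signedPartitionsIn.1 hbe).1 0), rectAppend_self]
  | succ N hN ih =>
    obtain ⟨p, rfl⟩ : ∃ p, N = p + 1 := ⟨N - 1, by omega⟩
    rw [sum_signedPartitionsIn_cons]
    · have e := ih fun nu => g (Fin.cons (k : ℤ) nu)
      refine Eq.trans (Finset.sum_congr rfl fun nu _ => ?_) (e.trans (Finset.sum_congr rfl fun be _ => ?_))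
      · rw [rectAppend_succ k (by omega) al, branch_cons_cons]
        exact (mem_signedPartitionsIn.1 (rectAppend_mem (by omega) hal)).1 0
      · rw [rectAppend_succ k hN]
    · intro nu hnu h0
      -- The upper row starts with at least three entries k, so mu 1 ≥ k, whereas mu 1 ≤ |nu 0| < k.
      have hb : between k (rectAppend k (p + 1 + 1 + 1) al) nu = ∅ := by
        rw [Finset.eq_empty_iff_forall_notMem]
        intro mu hmu
        rw [mem_between] at hmu
        have h1 := (hmu 1).1.1
        have h2 := (hmu 1).1.2.2.2
        rw [rectAppend_succ k (by omega), rectAppend_succ k (by omega),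
          rectAppend_succ k (by omega)] at h1
        rw [show (1 : Fin (p + 2)) = (0 : Fin (p + 1)).succ from rfl, extendAbs_castSucc_succ] at h2
        rw [show (1 : Fin (p + 2)).succ = (0 : Fin (p + 1)).succ.succ from rfl, Fin.cons_succ,
          Fin.cons_succ, Fin.cons_zero, hk] at h1
        have h3 := (mem_signedPartitionsIn.1 hnu).1 0
        have h4 := abs_of_mem_signedPartitionsIn hnu 0
        rw [Fin.castSucc_zero] at h2 h4
        have h5 : mu (0 : Fin (p + 1)).succ = mu 1 := rfl
        omega
      rw [branch, hb, Finset.sum_empty, zero_mul]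

/-- Moving one variable from a nearly rectangular character to its partner. -/
theorem sum_soEven_rectAppend_succ {k t N : ℕ} (hN : t + 1 ≤ N) (x : Fin (N + 1) → Rˣ)
    (w : Fin t → Rˣ) :
    ∑ al ∈ signedPartitionsIn t k, soEven (rectAppend k (N + 1) al) x * soEven al w =
      ∑ be ∈ signedPartitionsIn (t + 1) k, soEven (rectAppend k N be) (fun i => x i.castSucc) *
        soEven be (Fin.snoc w (x (Fin.last N)) : Fin (t + 1) → Rˣ) := by
  have h1 : ∀ al ∈ signedPartitionsIn t k, soEven (rectAppend k (N + 1) al) x * soEven al w =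
      ∑ be ∈ signedPartitionsIn (t + 1) k, branch k be al (x (Fin.last N)) *
        soEven (rectAppend k N be) (fun i => x i.castSucc) * soEven al w := by
    intro al hal
    rw [soEven_succ (rectAppend_mem (by omega) hal), sum_branch_rectAppend hal _ hN, Finset.sum_mul]
  -- For fixed be, the sum over al is now the branching expansion of the partner character.
  rw [Finset.sum_congr rfl h1, Finset.sum_comm]
  refine Finset.sum_congr rfl fun be hbe => ?_
  rw [soEven_succ hbe, Finset.mul_sum]
  refine Finset.sum_congr rfl fun al _ => ?_
  simp only [Fin.snoc_last, Fin.snoc_castSucc]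
  ring

/-- Moving the last element of the second summand to the end of the first one. -/
def moveLast (t m : ℕ) : Fin t ⊕ Fin (m + 1) ≃ Fin (t + 1) ⊕ Fin m where
  toFun := Sum.elim (fun i => Sum.inl i.castSucc)
    (Fin.lastCases (Sum.inl (Fin.last t)) fun i => Sum.inr i)
  invFun := Sum.elim (Fin.lastCases (Sum.inr (Fin.last m)) fun i => Sum.inl i)
    fun i => Sum.inr i.castSucc
  left_inv := by
    rintro (i | i)
    · simp
    · refine Fin.lastCases ?_ (fun i => ?_) i <;> simp
  right_inv := by
    rintro (i | i)
    · refine Fin.lastCases ?_ (fun i => ?_) i <;> simp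
    · simp

/-- Moving several variables from a nearly rectangular character to its partner. -/
theorem sum_soEven_rectAppend_add {k n m : ℕ} (x : Fin n → Rˣ) (y : Fin m → Rˣ) {t : ℕ}
    (h : t + m ≤ n) (w : Fin t → Rˣ) {M : ℕ} (w' : Fin M → Rˣ) (e : Fin M ≃ Fin t ⊕ Fin m)
    (he : w' = Sum.elim w y ∘ e) :
    ∑ al ∈ signedPartitionsIn t k,
        soEven (rectAppend k (n + m) al) (Fin.append x y) * soEven al w =
      ∑ be ∈ signedPartitionsIn M k, soEven (rectAppend k n be) x * soEven be w' := by
  -- The variables are handed over from the end of y; the bijection e records the rearrangement, and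
  -- symmetry is invoked only once, in the base case.
  induction m generalizing t with
  | zero =>
    let e' : Fin M ≃ Fin t := e.trans (Equiv.sumEmpty (Fin t) (Fin 0))
    obtain rfl : M = t := by simpa using Fintype.card_congr e'
    have hw : w' = w ∘ e' := by
      rw [he]
      funext i
      rcases hi : e i with a | a
      · simp [e', hi]
      · exact a.elim0
    have hx : Fin.append x y = x := by
      funext i
      exact Fin.append_left x y i
    rw [hx, hw]
    refine Finset.sum_congr rfl fun al hal => ?_
    rw [soEven_comp_perm hal]
    rfl
  | succ m ih =>
    have h1 := sum_soEven_rectAppend_succ (k := k) (N := n + m) (by omega)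
      (Fin.append x y : Fin (n + (m + 1)) → Rˣ) w
    refine h1.trans ?_
    have hx : (fun i : Fin (n + m) => (Fin.append x y : Fin (n + (m + 1)) → Rˣ) i.castSucc) =
        Fin.append x fun i => y i.castSucc := by
      funext i
      refine Fin.addCases (fun i => ?_) (fun i => ?_) i
      · rw [Fin.append_left]
        exact Fin.append_left x y i
      · rw [Fin.append_right]
        exact Fin.append_right x y i.castSucc
    have hlast : (Fin.append x y : Fin (n + (m + 1)) → Rˣ) (Fin.last (n + m)) = y (Fin.last m) :=
      Fin.append_right x y (Fin.last m)
    rw [hx, hlast]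
    refine ih (fun i => y i.castSucc) (by omega) _ (e.trans (moveLast t m)) ?_
    rw [he]
    funext i
    simp only [Function.comp_apply, Equiv.trans_apply]
    rcases e i with a | a
    · simp [moveLast]
    · refine Fin.lastCases ?_ (fun a => ?_) a <;> simp [moveLast]

/-! ### The rectangular identities -/

theorem rect_mem (k n : ℕ) : rect k n ∈ signedPartitionsIn n k :=
  mem_signedPartitionsIn.2 ⟨fun i => by simp [rect], fun i => by simp [rect],
    fun i j _ => by simp [rect]⟩

theorem soEven_rect_add {k n m : ℕ} (h : m ≤ n) (r : Fin n → Rˣ) (s : Fin m → Rˣ) :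
    soEven (rect k (n + m)) (Fin.append r s) =
      ∑ lam ∈ signedPartitionsIn m k, soEven (rectAppend k n lam) r * soEven lam s := by
  have h0 := sum_soEven_rectAppend_add (k := k) r s (t := 0) (by omega) Fin.elim0 s
    (Equiv.emptySum (Fin 0) (Fin m)).symm (by funext i; rfl)
  rw [← h0]
  have h1 : signedPartitionsIn 0 k = {Fin.elim0} := by
    ext f
    rw [Finset.mem_singleton]
    exact ⟨fun _ => Subsingleton.elim _ _, fun _ => mem_signedPartitionsIn.2
      ⟨fun i => i.elim0, fun i => i.elim0, fun i => i.elim0⟩⟩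
  have h2 : rectAppend k (n + m) (Fin.elim0 : Fin 0 → ℤ) = rect k (n + m) := by
    funext i
    rw [rectAppend, dif_neg (by have := i.isLt; omega), rect]
  rw [h1, Finset.sum_singleton, soEven_zero, mul_one, h2]

theorem soEven_rect_comp_equiv {k N N' : ℕ} (e : Fin N ≃ Fin N') (r : Fin N' → Rˣ) :
    soEven (rect k N) (r ∘ e) = soEven (rect k N') r := by
  obtain rfl : N = N' := by simpa using Fintype.card_congr e
  exact soEven_comp_perm (rect_mem k N) r e

theorem soEven_withSign_rect_add {k n m : ℕ} (h : m ≤ n) (ε : ℤˣ) (hε : 0 < m ∨ ε = 1)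
    (r : Fin n → Rˣ) (s : Fin m → Rˣ) :
    soEven (withSign ε (rect k (n + m))) (Fin.append r s) =
      ∑ lam ∈ signedPartitionsIn m k,
        soEven (rectAppend k n lam) r * soEven (withSign ε lam) s := by
  rcases Int.units_eq_one_or ε with rfl | rfl
  · simp only [withSign_one]
    exact soEven_rect_add h r s
  · obtain ⟨m, rfl⟩ : ∃ p, m = p + 1 := by
      rcases hε with hm | hε
      · exact ⟨m - 1, by omega⟩
      · exact absurd hε (by decide)
    -- Inverting the last variable of y flips the sign of the last part on both sides at once; this
    -- requires m > 0.
    let s' : Fin (m + 1) → Rˣ := Fin.snoc (fun i => s i.castSucc) (s (Fin.last m))⁻¹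
    have hs1 : ∀ i : Fin m, s' i.castSucc = s i.castSucc := fun i => by simp [s']
    have hs2 : s' (Fin.last m) = (s (Fin.last m))⁻¹ := by simp [s']
    have h1 : soEven (withSign (-1) (rect k (n + (m + 1)))) (Fin.append r s) =
        soEven (rect k (n + (m + 1))) (Fin.append r s') := by
      refine soEven_withSign_neg (n := n + m) (rect_mem k _) (fun i => ?_) ?_
      · refine Fin.addCases (fun i => ?_) (fun i => ?_) i
        · exact (Fin.append_left r s' i).trans (Fin.append_left r s i).symm
        · exact (Fin.append_right r s' i.castSucc).trans
            ((hs1 i).trans (Fin.append_right r s i.castSucc).symm)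
      · exact (Fin.append_right r s' (Fin.last m)).trans
          (hs2.trans (congrArg _ (Fin.append_right r s (Fin.last m)).symm))
    rw [h1, soEven_rect_add h]
    refine Finset.sum_congr rfl fun lam hlam => ?_
    rw [soEven_withSign_neg hlam hs1 hs2]

theorem soOdd_rect_add {k n m : ℕ} (h : m ≤ n + 1) (r : Fin n → Rˣ) (s : Fin m → Rˣ) :
    soOdd (rect k (n + m)) (Fin.append r s) =
      ∑ lam ∈ signedPartitionsIn m k,
        soEven (rectAppend k (n + 1) lam) (Fin.append r fun _ : Fin 1 => 1) * soEven lam s := by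
  rw [soOdd_rect, ← soEven_rect_add h]
  -- The rearrangement of (x, y, 1) into (x, 1, y).
  let e : Fin (n + m + 1) ≃ Fin (n + 1 + m) :=
    finSumFinEquiv.symm.trans <|
      (Equiv.sumCongr finSumFinEquiv.symm (Equiv.refl (Fin 1))).trans <|
      (Equiv.sumAssoc _ _ _).trans <|
      (Equiv.sumCongr (Equiv.refl _) (Equiv.sumComm _ _)).trans <|
      (Equiv.sumAssoc _ _ _).symm.trans <|
      (Equiv.sumCongr finSumFinEquiv (Equiv.refl _)).trans finSumFinEquiv
  rw [← soEven_rect_comp_equiv e]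
  congr 1
  have h1 : (Fin.snoc (Fin.append r s) 1 : Fin (n + m + 1) → Rˣ) =
      Fin.append (Fin.append r s) fun _ : Fin 1 => 1 :=
    (Fin.append_right_eq_snoc (Fin.append r s) fun _ : Fin 1 => 1).symm
  rw [h1]
  funext i
  refine Fin.addCases (fun i => ?_) (fun i => ?_) i
  · refine Fin.addCases (fun i => ?_) (fun i => ?_) i <;> simp [e]
  · simp only [Fin.append_right, Function.comp_apply, e, Equiv.trans_apply,
      finSumFinEquiv_symm_apply_natAdd]
    simp

end OrthogonalCharacters

theorem mainTheorem8 {R : Type*} [CommRing R] (n m k : ℕ) (r : Fin n → Rˣ) (s : Fin m → Rˣ) :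
    (m ≤ n → ∀ ε : ℤˣ, (0 < m ∨ ε = 1) →
      OrthogonalCharacters.soEven
          (OrthogonalCharacters.withSign ε (OrthogonalCharacters.rect k (n + m)))
          (Fin.append r s) =
        ∑ lam ∈ OrthogonalCharacters.signedPartitionsIn m k,
          OrthogonalCharacters.soEven (OrthogonalCharacters.rectAppend k n lam) r *
            OrthogonalCharacters.soEven (OrthogonalCharacters.withSign ε lam) s) ∧
    (m ≤ n + 1 →
      OrthogonalCharacters.soOdd (OrthogonalCharacters.rect k (n + m)) (Fin.append r s) =
        ∑ lam ∈ OrthogonalCharacters.signedPartitionsIn m k,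
          OrthogonalCharacters.soEven (OrthogonalCharacters.rectAppend k (n + 1) lam)
              (Fin.append r (fun _ : Fin 1 => 1)) *
            OrthogonalCharacters.soEven lam s) :=
  ⟨fun h ε hε => OrthogonalCharacters.soEven_withSign_rect_add h ε hε r s,
    fun h => OrthogonalCharacters.soOdd_rect_add h r s⟩
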